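/- Let $d\ge 2$, let $\mathcal I_1,\dots,\mathcal I_d$ be finite sets, $\mathcal I=\mathcal I_1\times\dots\times\mathcal I_d$, and let $G$ be the chain with vertices $1,\dots,d$ and edges $\{j,j+1\}$, $1\le j\le d-1$. Let ${\bf p}=({\bf p}(i))_{i\in\mathcal I}$ be a vector of random cell probabilities, that is, a random vector with ${\bf p}(i)>0$ for all $i\in\mathcal I$ and $\sum_{i\in\mathcal I}{\bf p}(i)=1$ almost surely. Write $\mathbb P_{\bf p}(X=i)={\bf p}(i)$, where $X=(X_1,\dots,X_d)$, and suppose that, almost surely, ${\bf p}$ factorizes with respect to $G$: $${\bf p}(i)=\frac{\prod_{j=1}^{d-1}\mathbb P_{\bf p}(X_j=i_j,\,X_{j+1}=i_{j+1})}{\prod_{j=2}^{d-1}\mathbb P_{\bf p}(X_j=i_j)},\qquad i\in\mathcal I .$$ Use the convention $X_0=X_{d+1}=0$ and $\mathcal I_0=\mathcal I_{d+1}=\{0\}$. Assume that the random vectors $$\bigl(\mathbb P_{\bf p}(X_j=l\mid X_{j-1}=k),\ l\in\mathcal I_j\bigr),\qquad k\in\mathcal I_{j-1},\ j=1,\dots,d,$$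 are jointly independent and non-degenerate (none of these vectors is almost surely constant), and that the random vectors $$\bigl(\mathbb P_{\bf p}(X_j=l\mid X_{j+1}=m),\ l\in\mathcal I_j\bigr),\qquad m\in\mathcal I_{j+1},\ j=1,\dots,d,$$ are jointly independent and non-degenerate. Then ${\bf p}$ has a hyper Dirichlet distribution with respect to $G$. Here the hyper Dirichlet distribution with respect to a decomposable graph is the one given by its moments: for a perfect order $C_1,\dots,C_K$ of the cliques, with separators $S_1=\emptyset$ and $S_l=C_l\cap(C_1\cup\dots\cup C_{l-1})$, there are positive numbers $\alpha$, $\alpha^{C_l}_k$ ($k\in\mathcal I_{C_l}$) and $\alpha^{S_l}_n$ ($n\in\mathcal I_{S_l}$), with $\alpha^{S_1}=\alpha$, where $\mathcal I_A=\prod_{v\in A}\mathcal I_v$, such that $\alpha^{S}_n=\sum_{k\in\mathcal I_C:\,k_S=n}\alpha^C_k$ for every separator $S$ (including $\emptyset$), every clique $C\supseteq S$ and every $n\in\mathcal I_S$, and $$\mathbb E\prod_{i\in\mathcal I}{\bf p}(i)^{r_i}=\frac{\mathcal Z(\alpha+r)}{\mathcal Z(\alpha)},\qquad \mathcal Z(\alpha)=\frac{\prod_{l=1}^{K}\prod_{k\in\mathcal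 I_{C_l}}\Gamma(\alpha^{C_l}_k)}{\Gamma(\alpha)\prod_{l=2}^{K}\prod_{n\in\mathcal I_{S_l}}\Gamma(\alpha^{S_l}_n)},$$ for all tables $r=(r_i)_{i\in\mathcal I}$ of non-negative integers, where $\alpha+r$ means that the total $\sum_i r_i$ is added to $\alpha$ and the marginal count $r^A_k=\sum_{i:\,i_A=k}r_i$ is added to $\alpha^A_k$ for $A=C_l,S_l$. For the chain, the cliques are the edges $\{j,j+1\}$ and the separators, besides $\emptyset$, are the sets $\{j\}$, $2\le j\le d-1$. -/

import Mathlib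

open MeasureTheory ProbabilityTheory

noncomputable section

namespace HyperDirichlet

/-! ### Marginal and conditional tables

`V` is the set of variables, `I v` the finite set of values of variable `v`, and
`(v : V) → I v` the set of cells. A marginal cell of `A : Finset V` is an element
of `(a : A) → I a`. -/

section Tables

variable {V : Type*} [Fintype V] [DecidableEq V] {I : V → Type*} [∀ v, Fintype (I v)]
  [∀ v, DecidableEq (I v)]

/-- The `A`-marginal `x^A(k) = ∑_{i : i_A = k} x(i)` of a table `x`. -/
def marginal {M : Type*} [AddCommMonoid M] (x : ((v : V) → I v) → M) (A : Finset V)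
    (k : (a : A) → I a) : M :=
  ∑ i : (v : V) → I v with A.restrict i = k, x i

/-- The conditional probability `P_x(X_v = m | X_A = k)`, where `x i = P_x(X = i)`.
For `A = ∅` (and its unique marginal cell) this is `P_x(X_v = m)` when `x` has total mass `1`. -/
def condProb (x : ((v : V) → I v) → ℝ) (v : V) (A : Finset V) (k : (a : A) → I a)
    (m : I v) : ℝ :=
  (∑ i : (v : V) → I v with A.restrict i = k ∧ i v = m, x i) / marginal x A k

end Tables

/-! ### Cliques, perfect orders, factorization -/

section Graph

variable {V : Type*} [DecidableEq V]

/-- The `l`-th separator `S_l = C_l ∩ (C_1 ∪ ⋯ ∪ C_{l-1})` of a sequence of sets;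
the first separator is `∅`. -/
def separator {K : ℕ} (C : Fin K → Finset V) (l : Fin K) : Finset V :=
  C l ∩ (Finset.Iio l).biUnion C

/-- `C_1, …, C_K` is a perfect order of the cliques (inclusion-maximal complete sets) of `G`:
each clique is listed exactly once and every separator, after the first, is contained in an
earlier clique. -/
structure IsPerfectCliqueOrder (G : SimpleGraph V) {K : ℕ} (C : Fin K → Finset V) : Prop where
  injective : Function.Injective C
  mem_range : ∀ D : Finset V,
    (∃ l, C l = D) ↔ Maximal (fun A : Finset V => G.IsClique (A : Set V)) D
  running : ∀ l : Fin K, 0 < l.val → ∃ i : Fin K, i < l ∧ separator C l ⊆ C i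

variable [Fintype V] {I : V → Type*} [∀ v, Fintype (I v)] [∀ v, DecidableEq (I v)]

/-- The probability table `x` factorizes with respect to the decomposable graph `G`:
`x(i) = ∏_l x^{C_l}(i_{C_l}) / ∏_{l ≥ 2} x^{S_l}(i_{S_l})` for a perfect order of the cliques. -/
def Factorizes (G : SimpleGraph V) (x : ((v : V) → I v) → ℝ) : Prop :=
  ∃ (K : ℕ) (C : Fin K → Finset V), IsPerfectCliqueOrder G C ∧
    ∀ i : (v : V) → I v,
      x i = (∏ l : Fin K, marginal x (C l) ((C l).restrict i)) /
        ∏ l : Fin K with 0 < l.val, marginal x (separator C l) ((separator C l).restrict i)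

/-- The constant `Z(α) = ∏_l ∏_k Γ(α^{C_l}_k) / (Γ(α) ∏_{l ≥ 2} ∏_k Γ(α^{S_l}_k))`.
The factor `Γ(α)` is the one of the first separator `S_1 = ∅`, which has a single marginal cell. -/
def normConst {K : ℕ} (C : Fin K → Finset V) (α : (A : Finset V) → ((a : A) → I a) → ℝ) : ℝ :=
  (∏ l : Fin K, ∏ k : (a : C l) → I a, Real.Gamma (α (C l) k)) /
    ∏ l : Fin K, ∏ k : (a : separator C l) → I a, Real.Gamma (α (separator C l) k)

/-- The family `α` (only its members at cliques and separators matter) is a system of hyper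
Dirichlet parameters: positive numbers such that `α^S_n = ∑_{k ∈ I_C, k_S = n} α^C_k` whenever
the separator `S` (with `S_1 = ∅` included) is contained in the clique `C`. -/
structure IsHyperParameter {K : ℕ} (C : Fin K → Finset V)
    (α : (A : Finset V) → ((a : A) → I a) → ℝ) : Prop where
  clique_pos : ∀ l k, 0 < α (C l) k
  separator_pos : ∀ l n, 0 < α (separator C l) n
  consistent : ∀ (l m : Fin K) (h : separator C l ⊆ C m) (n : (a : separator C l) → I a),
    α (separator C l) n =
      ∑ k : (a : C m) → I a with Finset.restrict₂ (π := I) h k = n, α (C m) k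

variable {Ω : Type*} [MeasurableSpace Ω]

/-- `p` is a vector of random cell probabilities: a random vector of positive numbers with
sum `1`. -/
structure IsRandomProbability (μ : Measure Ω) (p : Ω → ((v : V) → I v) → ℝ) : Prop where
  measurable : ∀ i, Measurable fun ω => p ω i
  pos : ∀ᵐ ω ∂μ, ∀ i, 0 < p ω i
  sum_eq_one : ∀ᵐ ω ∂μ, ∑ i, p ω i = 1

/-- `p` has a hyper Dirichlet distribution with respect to the decomposable graph `G`. The
distribution is given by its moments,
`E ∏_i p(i)^{r_i} = Z(α + r) / Z(α)` for all tables `r` of non-negative integers,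
where `r` is added to `α` through its marginals `r^{C_l}`, `r^{S_l}`. -/
def HasHyperDirichletLaw (G : SimpleGraph V) (μ : Measure Ω)
    (p : Ω → ((v : V) → I v) → ℝ) : Prop :=
  ∃ (K : ℕ) (C : Fin K → Finset V), IsPerfectCliqueOrder G C ∧
    ∃ α : (A : Finset V) → ((a : A) → I a) → ℝ, IsHyperParameter C α ∧
      ∀ r : ((v : V) → I v) → ℕ,
        ∫ ω, ∏ i, p ω i ^ r i ∂μ =
          normConst C (fun A k => α A k + ((marginal r A k : ℕ) : ℝ)) / normConst C α

/-- Parameter independence of `p` with respect to the DAG with parent function `pa`: the random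
vectors `(P_p(X_v = m | X_{pa v} = k), m ∈ I v)`, for all `v` and all `k ∈ I_{pa v}`, are jointly
independent and non-degenerate (none is almost surely constant). -/
structure ParameterIndependence (μ : Measure Ω) (p : Ω → ((v : V) → I v) → ℝ)
    (pa : V → Finset V) : Prop where
  indep : iIndepFun (fun (s : Σ v : V, ((a : pa v) → I a)) (ω : Ω) (m : I s.1) =>
    condProb (p ω) s.1 (pa s.1) s.2 m) μ
  nondegenerate : ∀ (v : V) (k : (a : pa v) → I a),
    ¬ ∃ c : I v → ℝ, ∀ᵐ ω ∂μ, condProb (p ω) v (pa v) k = c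

end Graph

/-! ### The chain -/

/-- Parents in the DAG `1 → 2 → ⋯ → d`: the first vertex has none, `j` has parent `j - 1`. -/
def forwardParents (d : ℕ) (j : Fin d) : Finset (Fin d) :=
  Finset.univ.filter fun i => i.val + 1 = j.val

/-- Parents in the DAG `1 ← 2 ← ⋯ ← d`: the last vertex has none, `j` has parent `j + 1`. -/
def backwardParents (d : ℕ) (j : Fin d) : Finset (Fin d) :=
  Finset.univ.filter fun i => j.val + 1 = i.val

end HyperDirichlet

end

open MeasureTheory ProbabilityTheory

noncomputable section

set_option linter.unusedSectionVars false

namespace HyperDirichlet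

/-! ### Moment sequences with constant cross ratios -/

/-! On one edge {u, v}, forward independence makes the marginal of u independent of the conditional
laws of v given u. The moments M of the two-way table therefore split into a function of the row
totals times one factor per row (`ParameterIndependence.integral_pair`), and backward independence
gives the same with columns. The cross ratio M(r+e_i+e_j) M(r) / (M(r+e_i) M(r+e_j)) then sees only
row totals if i and j lie in different rows, and only column totals if they lie in different
columns. Comparing the two, it sees only the grand total (`polya_of_row_col`). A recursion on
moments, with no density involved, turns this into the Pólya urn rule: the predictive weight of cell
i is (M(e_i) + c r_i) / (1 + c|r|) (`polya_of_crossRatio`). For c > 0 these are Dirichlet moments; c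
= 0 would make the table constant, against non-degeneracy (`exists_polya_edge`).

Consecutive edges share a vertex, and the law of that vertex determines c (`IsPolyaVertex.unique`),
so a single c serves the whole chain. The margins of the table a = E p / c are then the Dirichlet
parameters of every forward conditional vector (`exists_condMoment_add_single`).

The moment formula follows by adding one observation i to r. On the left this multiplies the moment
by the product of the forward conditional probabilities of a + r at i
(`ParameterIndependence.integral_table_add_single`). On the right, Γ(t+1) = tΓ(t) multiplies the
constant by clique margins over separator margins at i (`normConst_marginal_add_single`). For the
chain these two factors agree (`IsPerfectCliqueOrder.prod_condProb_forwardParents`). -/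

/-- Induction on tables of non-negative integers by adding one observation at a time. -/
theorem table_induction {ι : Type*} [Fintype ι] [DecidableEq ι] {P : (ι → ℕ) → Prop}
    (h0 : P 0) (hs : ∀ r i, P r → P (r + Pi.single i 1)) (r : ι → ℕ) : P r := by
  induction hn : ∑ i, r i generalizing r with
  | zero =>
    have : r = 0 := by
      funext i
      simpa using (Finset.sum_eq_zero_iff.1 hn) i (Finset.mem_univ i)
    rwa [this]
  | succ n ih =>
    obtain ⟨i, -, hi⟩ : ∃ i ∈ Finset.univ, r i ≠ 0 := by
      apply Finset.exists_ne_zero_of_sum_ne_zero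
      omega
    have hr : r = (r - Pi.single i 1) + Pi.single i 1 := by
      funext j
      rcases eq_or_ne j i with rfl | h
      · simp; omega
      · simp [h]
    rw [hr]
    apply hs
    apply ih
    have := congrArg (fun f => ∑ j, f j) hr
    simp only [Pi.add_apply, Finset.sum_add_distrib, Finset.sum_pi_single', Finset.mem_univ,
      if_true] at this
    simp only [Pi.sub_apply] at this ⊢
    omega

theorem sum_add_single {ι : Type*} [Fintype ι] [DecidableEq ι] (r : ι → ℕ) (i : ι) :
    ∑ j, (r + Pi.single i 1 : ι → ℕ) j = ∑ j, r j + 1 := by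
  simp [Finset.sum_add_distrib]

/-- A positive normalized system of moments of a probability vector whose cross ratios at distinct
cells only depend on the total is that of a Pólya urn. -/
theorem polya_of_crossRatio {ι : Type*} [Fintype ι] [DecidableEq ι] [Nontrivial ι]
    (M : (ι → ℕ) → ℝ) (hpos : ∀ r, 0 < M r) (h0 : M 0 = 1)
    (hsum : ∀ r, ∑ i, M (r + Pi.single i 1) = M r) (U : ℕ → ℝ)
    (hU : ∀ r i j, i ≠ j → M (r + Pi.single i 1 + Pi.single j 1) * M r =
      U (∑ k, r k) * (M (r + Pi.single i 1) * M (r + Pi.single j 1))) :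
    ∃ c : ℝ, 0 ≤ c ∧ ∀ r i, M (r + Pi.single i 1) * (1 + c * (∑ k, r k : ℕ)) =
      M r * (M (Pi.single i 1) + c * r i) := by
  obtain ⟨a, b, hab⟩ := exists_pair_ne ι
  have hsurj : ∀ n : ℕ, ∑ k, (Pi.single a n : ι → ℕ) k = n := by simp
  have hUpos : ∀ n, 0 < U n := by
    intro n
    have h := hU (Pi.single a n) a b hab
    rw [hsurj] at h
    have h1 := mul_pos (hpos (Pi.single a n + Pi.single a 1 + Pi.single b 1)) (hpos (Pi.single a n))
    rw [h] at h1
    exact pos_of_mul_pos_left h1 (mul_pos (hpos _) (hpos _)).le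
  -- `H` solves H(n+1) U(n) = H(n), so that the rescaled predictive weight `T i` of cell i ignores
  -- observations in all other cells.
  let H : ℕ → ℝ := fun n => ∏ m ∈ Finset.range n, (U m)⁻¹
  have hH : ∀ n, 0 < H n := fun n => Finset.prod_pos fun m _ => inv_pos.2 (hUpos m)
  have hHs : ∀ n, H (n + 1) * U n = H n := by
    intro n
    simp only [H, Finset.prod_range_succ]
    rw [mul_assoc, inv_mul_cancel₀ (hUpos n).ne', mul_one]
  let T : ι → (ι → ℕ) → ℝ := fun i r => M (r + Pi.single i 1) / M r * H (∑ k, r k)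
  have hT1 : ∀ r i j, i ≠ j → T i (r + Pi.single j 1) = T i r := by
    intro r i j hij
    simp only [T]
    rw [sum_add_single, ← hHs (∑ k, r k)]
    have h := hU r i j hij
    rw [add_right_comm] at h
    have h1 := (hpos r).ne'
    have h2 := (hpos (r + Pi.single j 1)).ne'
    field_simp
    linear_combination H (∑ k, r k + 1) * h
  have hTs : ∀ r, ∑ i, T i r = H (∑ k, r k) := by
    intro r
    simp only [T]
    rw [← Finset.sum_mul, ← Finset.sum_div, hsum, div_self (hpos r).ne', one_mul]
  -- The weights sum to `H`, and an observation at i moves only the i-th of them, which must absorb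
  -- the whole increment of `H`.
  have hT2 : ∀ r i, T i (r + Pi.single i 1) = T i r + (H (∑ k, r k + 1) - H (∑ k, r k)) := by
    intro r i
    have h1 := hTs r
    have h2 := hTs (r + Pi.single i 1)
    rw [← Finset.add_sum_erase _ _ (Finset.mem_univ i)] at h1 h2
    rw [Finset.sum_congr rfl (g := fun j => T j r)
      (fun j hj => hT1 r j i (Finset.ne_of_mem_erase hj)), sum_add_single] at h2
    linarith
  -- An observation at b raises the total but is invisible to `T a`, so the increments of `H` at n
  -- and n + 1 coincide and `H` is affine.
  have hδ : ∀ n, H (n + 2) - H (n + 1) = H (n + 1) - H n := by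
    intro n
    have h1 := hT2 (Pi.single a n) a
    have h2 := hT2 (Pi.single a n + Pi.single b 1) a
    rw [hT1 _ _ _ hab, sum_add_single, hsurj, add_right_comm, hT1 _ _ _ hab] at h2
    rw [hsurj] at h1
    have : n + 1 + 1 = n + 2 := rfl
    rw [this] at h2
    linarith
  have hH0 : H 0 = 1 := by simp [H]
  have hd : ∀ n, H (n + 1) - H n = H 1 - 1 := by
    intro n
    induction n with
    | zero => simp [hH0]
    | succ n ih => rw [hδ n, ih]
  have hlin : ∀ n : ℕ, H n = 1 + (H 1 - 1) * n := by
    intro n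
    induction n with
    | zero => simp [hH0]
    | succ n ih =>
      have := hd n
      push_cast
      linarith
  have hT : ∀ i r, T i r = M (Pi.single i 1) + (H 1 - 1) * r i := by
    intro i r
    induction r using table_induction with
    | h0 => simp [T, h0, hH0]
    | hs r j ih =>
      rcases eq_or_ne i j with rfl | hij
      · rw [hT2, ih, hd]
        simp
        ring
      · rw [hT1 _ _ _ hij, ih]
        simp [hij]
  refine ⟨H 1 - 1, ?_, fun r i => ?_⟩
  -- With negative slope the affine function `H` would eventually be negative.
  · by_contra hc
    push Not at hc
    obtain ⟨n, hn⟩ := exists_nat_gt (1 / (-(H 1 - 1)))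
    have h := hH n
    rw [hlin] at h
    rw [div_lt_iff₀ (by linarith)] at hn
    linarith
  · rw [← hlin, ← hT]
    simp only [T]
    have := (hpos r).ne'
    field_simp

/-- If the moments of a two-way table factorize both along rows and along columns, then they are
those of a Pólya urn. -/
theorem polya_of_row_col {K L : Type*} [Fintype K] [DecidableEq K] [Nontrivial K]
    [Fintype L] [DecidableEq L] [Nontrivial L]
    (M : (K × L → ℕ) → ℝ) (hpos : ∀ r, 0 < M r) (h0 : M 0 = 1)
    (hsum : ∀ r, ∑ i, M (r + Pi.single i 1) = M r)
    (f : (K → ℕ) → ℝ) (F : K → (L → ℕ) → ℝ) (g : (L → ℕ) → ℝ) (G : L → (K → ℕ) → ℝ)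
    (hrow : ∀ r, M r = f (fun k => ∑ l, r (k, l)) * ∏ k, F k (fun l => r (k, l)))
    (hcol : ∀ r, M r = g (fun l => ∑ k, r (k, l)) * ∏ l, G l (fun k => r (k, l))) :
    ∃ c : ℝ, 0 ≤ c ∧ ∀ r i, M (r + Pi.single i 1) * (1 + c * (∑ k, r k : ℕ)) =
      M r * (M (Pi.single i 1) + c * r i) := by
  let D : (K × L → ℕ) → K × L → K × L → ℝ := fun r i j =>
    M (r + Pi.single i 1 + Pi.single j 1) * M r / (M (r + Pi.single i 1) * M (r + Pi.single j 1))
  let cf : (K → ℕ) → K → K → ℝ := fun ρ k k' =>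
    f (ρ + Pi.single k 1 + Pi.single k' 1) * f ρ / (f (ρ + Pi.single k 1) * f (ρ + Pi.single k' 1))
  let cg : (L → ℕ) → L → L → ℝ := fun ρ k k' =>
    g (ρ + Pi.single k 1 + Pi.single k' 1) * g ρ / (g (ρ + Pi.single k 1) * g (ρ + Pi.single k' 1))
  have rowsum : ∀ (r : K × L → ℕ) (i : K × L), (fun k => ∑ l, (r + Pi.single i 1 : K × L → ℕ) (k, l)) =
      (fun k => ∑ l, r (k, l)) + Pi.single i.1 1 := by
    rintro r ⟨a, b⟩
    funext k
    rcases eq_or_ne k a with rfl | h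
    · simp [Finset.sum_add_distrib, Pi.single_apply]
    · simp [h]
  have colsum : ∀ (r : K × L → ℕ) (i : K × L), (fun l => ∑ k, (r + Pi.single i 1 : K × L → ℕ) (k, l)) =
      (fun l => ∑ k, r (k, l)) + Pi.single i.2 1 := by
    rintro r ⟨a, b⟩
    funext k
    rcases eq_or_ne k b with rfl | h
    · simp [Finset.sum_add_distrib, Pi.single_apply]
    · simp [h]
  have row_ne : ∀ (r : K × L → ℕ) (i : K × L) (k : K), k ≠ i.1 →
      (fun l => (r + Pi.single i 1 : K × L → ℕ) (k, l)) = fun l => r (k, l) := by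
    rintro r ⟨a, b⟩ k h
    funext l
    simp [show k ≠ a from h]
  have col_ne : ∀ (r : K × L → ℕ) (i : K × L) (l : L), l ≠ i.2 →
      (fun k => (r + Pi.single i 1 : K × L → ℕ) (k, l)) = fun k => r (k, l) := by
    rintro r ⟨a, b⟩ k h
    funext l
    simp [show k ≠ b from h]
  -- Each row receives at most one of the two new cells, so the row factors drop out of the cross
  -- ratio.
  have row_eq : ∀ (r : K × L → ℕ) (i j : K × L), i.1 ≠ j.1 →
      (∏ k, F k (fun l => (r + Pi.single i 1 + Pi.single j 1 : K × L → ℕ) (k, l))) *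
        (∏ k, F k (fun l => r (k, l))) =
      (∏ k, F k (fun l => (r + Pi.single i 1 : K × L → ℕ) (k, l))) *
        (∏ k, F k (fun l => (r + Pi.single j 1 : K × L → ℕ) (k, l))) := by
    intro r i j hij
    rw [← Finset.prod_mul_distrib, ← Finset.prod_mul_distrib]
    refine Finset.prod_congr rfl fun k _ => ?_
    rcases eq_or_ne k j.1 with rfl | h
    · rw [row_ne r i _ hij.symm, add_right_comm, row_ne _ i _ hij.symm, mul_comm]
    · rw [row_ne _ j _ h, row_ne _ j _ h]
  have col_eq : ∀ (r : K × L → ℕ) (i j : K × L), i.2 ≠ j.2 →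
      (∏ k, G k (fun l => (r + Pi.single i 1 + Pi.single j 1 : K × L → ℕ) (l, k))) *
        (∏ k, G k (fun l => r (l, k))) =
      (∏ k, G k (fun l => (r + Pi.single i 1 : K × L → ℕ) (l, k))) *
        (∏ k, G k (fun l => (r + Pi.single j 1 : K × L → ℕ) (l, k))) := by
    intro r i j hij
    rw [← Finset.prod_mul_distrib, ← Finset.prod_mul_distrib]
    refine Finset.prod_congr rfl fun k _ => ?_
    rcases eq_or_ne k j.2 with rfl | h
    · rw [col_ne r i _ hij.symm, add_right_comm, col_ne _ i _ hij.symm, mul_comm]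
    · rw [col_ne _ j _ h, col_ne _ j _ h]
  have cancel : ∀ a b c d A B C E : ℝ, A * B = C * E → C * E ≠ 0 →
      a * A * (b * B) / (c * C * (d * E)) = a * b / (c * d) := by
    intro a b c d A B C E h hne
    have h1 : a * A * (b * B) = a * b * (C * E) := by rw [← h]; ring
    have h2 : c * C * (d * E) = c * d * (C * E) := by ring
    rw [h1, h2, mul_div_mul_right _ _ hne]
  have hFne : ∀ r : K × L → ℕ, (∏ k, F k (fun l => r (k, l))) ≠ 0 := by
    intro r h
    have := hpos r
    rw [hrow, h] at this
    simp at this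
  have hGne : ∀ r : K × L → ℕ, (∏ k, G k (fun l => r (l, k))) ≠ 0 := by
    intro r h
    have := hpos r
    rw [hcol, h] at this
    simp at this
  have hDf : ∀ r i j, i.1 ≠ j.1 → D r i j = cf (fun k => ∑ l, r (k, l)) i.1 j.1 := by
    intro r i j hij
    simp only [D, cf]
    rw [hrow (r + Pi.single i 1 + Pi.single j 1), hrow r, hrow (r + Pi.single i 1),
      hrow (r + Pi.single j 1), cancel _ _ _ _ _ _ _ _ (row_eq r i j hij)
        (mul_ne_zero (hFne _) (hFne _)), rowsum, rowsum, rowsum]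
  have hDg : ∀ r i j, i.2 ≠ j.2 → D r i j = cg (fun l => ∑ k, r (k, l)) i.2 j.2 := by
    intro r i j hij
    simp only [D, cg]
    rw [hcol (r + Pi.single i 1 + Pi.single j 1), hcol r, hcol (r + Pi.single i 1),
      hcol (r + Pi.single j 1), cancel _ _ _ _ _ _ _ _ (col_eq r i j hij)
        (mul_ne_zero (hGne _) (hGne _)), colsum, colsum, colsum]
  have hfg : ∀ (r : K × L → ℕ) k k' l l', k ≠ k' → l ≠ l' →
      cf (fun k => ∑ l, r (k, l)) k k' = cg (fun l => ∑ k, r (k, l)) l l' := by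
    intro r k k' l l' hk hl
    rw [← hDf r (k, l) (k', l') hk, hDg r (k, l) (k', l') hl]
  obtain ⟨k₀, k₁, hk⟩ := exists_pair_ne K
  obtain ⟨l₀, l₁, hl⟩ := exists_pair_ne L
  let U : ℕ → ℝ := fun n => cg (Pi.single l₀ n) l₀ l₁
  have hcf : ∀ (r : K × L → ℕ) k k', k ≠ k' →
      cf (fun k => ∑ l, r (k, l)) k k' = U (∑ i, r i) := by
    intro r k k' hkk
    -- This table has the row totals of r but all its mass in column `l₀`, so its column totals
    -- remember only the grand total.
    have h := hfg (fun i => if i.2 = l₀ then ∑ l, r (i.1, l) else 0) k k' l₀ l₁ hkk hl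
    have h1 : (fun l => ∑ k, (if l = l₀ then ∑ l', r (k, l') else 0)) =
        Pi.single l₀ (∑ i, r i) := by
      funext l
      rcases eq_or_ne l l₀ with rfl | hne
      · simp [Fintype.sum_prod_type]
      · simp [hne]
    simp only [Finset.sum_ite_eq', Finset.mem_univ, if_true] at h
    rw [h, h1]
  have hD : ∀ r i j, i ≠ j → D r i j = U (∑ k, r k) := by
    intro r i j hij
    by_cases h1 : i.1 = j.1
    · have h2 : i.2 ≠ j.2 := fun h2 => hij (Prod.ext h1 h2)
      -- For two cells of one row, the column form of the cross ratio is exchanged for the row form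
      -- at two arbitrary distinct rows.
      rw [hDg r i j h2, ← hfg r k₀ k₁ _ _ hk h2, hcf r k₀ k₁ hk]
    · rw [hDf r i j h1, hcf r _ _ h1]
  refine polya_of_crossRatio M hpos h0 hsum U fun r i j hij => ?_
  rw [← hD r i j hij]
  simp only [D]
  rw [div_mul_cancel₀ _ (mul_pos (hpos _) (hpos _)).ne']

/-! ### One- and two-way marginals -/

section Tables

variable {V : Type*} [Fintype V] [DecidableEq V] {I : V → Type*} [∀ v, Fintype (I v)]
  [∀ v, DecidableEq (I v)]

/-- The one-way marginal of a table. -/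
def vert {M : Type*} [AddCommMonoid M] (x : ((v : V) → I v) → M) (u : V) (k : I u) : M :=
  ∑ i : (v : V) → I v with i u = k, x i

/-- The two-way marginal of a table. -/
def pair {M : Type*} [AddCommMonoid M] (x : ((v : V) → I v) → M) (u v : V) (k : I u) (m : I v) :
    M :=
  ∑ i : (v : V) → I v with i u = k ∧ i v = m, x i

theorem pair_comm {M : Type*} [AddCommMonoid M] (x : ((v : V) → I v) → M) (u v : V) (k : I u)
    (m : I v) : pair x u v k m = pair x v u m k := by
  simp only [pair, and_comm]

theorem sum_pair_right {M : Type*} [AddCommMonoid M] (x : ((v : V) → I v) → M) (u v : V)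
    (k : I u) : ∑ m, pair x u v k m = vert x u k := by
  simp only [pair, vert, ← Finset.filter_filter]
  exact Finset.sum_fiberwise _ (fun i : (v : V) → I v => i v) x

theorem sum_pair_left {M : Type*} [AddCommMonoid M] (x : ((v : V) → I v) → M) (u v : V)
    (m : I v) : ∑ k, pair x u v k m = vert x v m := by
  simp only [pair_comm x u v, sum_pair_right]

theorem sum_vert {M : Type*} [AddCommMonoid M] (x : ((v : V) → I v) → M) (u : V) :
    ∑ k, vert x u k = ∑ i, x i :=
  Finset.sum_fiberwise _ (fun i : (v : V) → I v => i u) x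

theorem restrict_eq_iff_of_eq_singleton {A : Finset V} {u : V} (hA : A = {u})
    (i j : (v : V) → I v) : A.restrict i = A.restrict j ↔ i u = j u := by
  subst hA
  constructor
  · intro h
    exact congrFun h ⟨u, Finset.mem_singleton_self u⟩
  · intro h
    funext ⟨a, ha⟩
    obtain rfl := Finset.mem_singleton.1 ha
    exact h

theorem restrict_surjective [∀ v, Nonempty (I v)] {A : Finset V} (k : (a : A) → I a) :
    ∃ i : (v : V) → I v, A.restrict i = k := by
  classical
  refine ⟨fun v => if h : v ∈ A then k ⟨v, h⟩ else Classical.arbitrary _, ?_⟩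
  funext ⟨a, ha⟩
  simp [Finset.restrict, ha]

theorem marginal_of_eq_singleton {M : Type*} [AddCommMonoid M] (x : ((v : V) → I v) → M)
    {A : Finset V} {u : V} (hA : A = {u}) (i : (v : V) → I v) :
    marginal x A (A.restrict i) = vert x u (i u) := by
  simp only [marginal, vert, restrict_eq_iff_of_eq_singleton hA]

theorem marginal_empty {M : Type*} [AddCommMonoid M] (x : ((v : V) → I v) → M)
    {A : Finset V} (hA : A = ∅) (k : (a : A) → I a) : marginal x A k = ∑ i, x i := by
  subst hA
  have : ∀ i : (v : V) → I v, (∅ : Finset V).restrict i = k := by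
    intro i
    funext ⟨a, ha⟩
    simp at ha
  simp [marginal, this]

/-- The numerator of `condProb`. -/
def joint {M : Type*} [AddCommMonoid M] (x : ((v : V) → I v) → M) (v : V) (A : Finset V)
    (k : (a : A) → I a) (m : I v) : M :=
  ∑ i : (v : V) → I v with A.restrict i = k ∧ i v = m, x i

theorem condProb_eq (x : ((v : V) → I v) → ℝ) (v : V) (A : Finset V)
    (k : (a : A) → I a) (m : I v) : condProb x v A k m = joint x v A k m / marginal x A k := rfl

theorem sum_joint {M : Type*} [AddCommMonoid M] (x : ((v : V) → I v) → M) (v : V) (A : Finset V)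
    (k : (a : A) → I a) : ∑ m, joint x v A k m = marginal x A k := by
  simp only [joint, marginal, ← Finset.filter_filter]
  exact Finset.sum_fiberwise _ (fun i : (v : V) → I v => i v) x

theorem joint_of_eq_singleton {M : Type*} [AddCommMonoid M] (x : ((v : V) → I v) → M) (v : V)
    {A : Finset V} {u : V} (hA : A = {u}) (i : (v : V) → I v) (m : I v) :
    joint x v A (A.restrict i) m = pair x u v (i u) m := by
  simp only [joint, pair, restrict_eq_iff_of_eq_singleton hA]

theorem joint_empty {M : Type*} [AddCommMonoid M] (x : ((v : V) → I v) → M) (v : V)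
    {A : Finset V} (hA : A = ∅) (k : (a : A) → I a) (m : I v) :
    joint x v A k m = vert x v m := by
  subst hA
  have : ∀ i : (v : V) → I v, (∅ : Finset V).restrict i = k := by
    intro i
    funext ⟨a, ha⟩
    simp at ha
  simp [joint, vert, this]

theorem vert_pos [∀ v, Nonempty (I v)] {x : ((v : V) → I v) → ℝ} (hx : ∀ i, 0 < x i) (u : V)
    (k : I u) : 0 < vert x u k := by
  refine Finset.sum_pos (fun i _ => hx i) ⟨Function.update (fun v => Classical.arbitrary _) u k, ?_⟩
  simp

theorem pair_pos [∀ v, Nonempty (I v)] {x : ((v : V) → I v) → ℝ} (hx : ∀ i, 0 < x i) {u v : V}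
    (huv : u ≠ v) (k : I u) (m : I v) : 0 < pair x u v k m := by
  refine Finset.sum_pos (fun i _ => hx i)
    ⟨Function.update (Function.update (fun v => Classical.arbitrary _) u k) v m, ?_⟩
  simp [huv]

theorem marginal_pos [∀ v, Nonempty (I v)] {x : ((v : V) → I v) → ℝ} (hx : ∀ i, 0 < x i)
    (A : Finset V) (k : (a : A) → I a) : 0 < marginal x A k := by
  obtain ⟨i, hi⟩ := restrict_surjective k
  exact Finset.sum_pos (fun i _ => hx i) ⟨i, by simp [hi]⟩

end Tables

/-! ### Moments under parameter independence -/

section Moments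

variable {V : Type*} [Fintype V] [DecidableEq V] {I : V → Type*} [∀ v, Fintype (I v)]
  [∀ v, DecidableEq (I v)] {Ω : Type*} [MeasurableSpace Ω] {μ : Measure Ω}
  {p : Ω → ((v : V) → I v) → ℝ}

theorem IsRandomProbability.measurable_vert (hp : IsRandomProbability μ p) (u : V) (k : I u) :
    Measurable fun ω => vert (p ω) u k :=
  Finset.measurable_fun_sum _ fun i _ => hp.measurable i

theorem IsRandomProbability.measurable_pair (hp : IsRandomProbability μ p) (u v : V) (k : I u)
    (m : I v) : Measurable fun ω => pair (p ω) u v k m :=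
  Finset.measurable_fun_sum _ fun i _ => hp.measurable i

theorem IsRandomProbability.measurable_condProb (hp : IsRandomProbability μ p) (v : V)
    (A : Finset V) (k : (a : A) → I a) (m : I v) :
    Measurable fun ω => condProb (p ω) v A k m :=
  (Finset.measurable_fun_sum _ fun i _ => hp.measurable i).div
    (Finset.measurable_fun_sum _ fun i _ => hp.measurable i)

theorem IsRandomProbability.measurable_condProb_vec (hp : IsRandomProbability μ p) (v : V)
    (A : Finset V) (k : (a : A) → I a) :
    Measurable fun ω => (fun m => condProb (p ω) v A k m) :=
  measurable_pi_lambda _ fun m => hp.measurable_condProb v A k m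

theorem IsRandomProbability.nonempty [IsProbabilityMeasure μ] (hp : IsRandomProbability μ p)
    (v : V) : Nonempty (I v) := by
  obtain ⟨ω, hω⟩ := hp.sum_eq_one.exists
  by_contra h
  rw [not_nonempty_iff] at h
  have : IsEmpty ((v : V) → I v) := ⟨fun i => h.elim (i v)⟩
  simp at hω

variable [∀ v, Nonempty (I v)]

/-- The marginal of a vertex is almost surely a function of the conditional probabilities of
vertices of at most the same rank. -/
theorem ParameterIndependence.exists_measurable_vert {pa : V → Finset V}
    (hp : IsRandomProbability μ p) (rank : V → ℕ)
    (hpa : ∀ v, pa v = ∅ ∨ ∃ u, pa v = {u} ∧ rank u < rank v) (n : ℕ) (v : V)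
    (hv : rank v < n) :
    ∃ Y : I v → Ω → ℝ, (∀ m, Measurable[⨆ s ∈ {s : Σ v : V, ((a : pa v) → I a) | rank s.1 < n},
        MeasurableSpace.comap (fun ω (m : I s.1) => condProb (p ω) s.1 (pa s.1) s.2 m)
          inferInstance] (Y m)) ∧
      ∀ᵐ ω ∂μ, ∀ m, Y m ω = vert (p ω) v m := by
  have hmeas : ∀ (v : V) (k : (a : pa v) → I a) (m : I v), rank v < n →
      Measurable[⨆ s ∈ {s : Σ v : V, ((a : pa v) → I a) | rank s.1 < n},
        MeasurableSpace.comap (fun ω (m : I s.1) => condProb (p ω) s.1 (pa s.1) s.2 m)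
          inferInstance] (fun ω => condProb (p ω) v (pa v) k m) := by
    intro v k m hv
    have h1 : Measurable[MeasurableSpace.comap (fun ω (m : I v) => condProb (p ω) v (pa v) k m)
        inferInstance] (fun ω (m : I v) => condProb (p ω) v (pa v) k m) :=
      comap_measurable _
    have h2 := (measurable_pi_apply m).comp h1
    refine h2.mono ?_ le_rfl
    exact le_iSup₂_of_le (f := fun (s : Σ v : V, ((a : pa v) → I a))
      (_ : s ∈ {s : Σ v : V, ((a : pa v) → I a) | rank s.1 < n}) =>
        MeasurableSpace.comap (fun ω (m : I s.1) => condProb (p ω) s.1 (pa s.1) s.2 m)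
          inferInstance) ⟨v, k⟩ hv le_rfl
  induction hr : rank v using Nat.strong_induction_on generalizing v with
  | _ N ih =>
    rcases hpa v with h0 | ⟨u, hu, hlt⟩
    · refine ⟨fun m ω => condProb (p ω) v (pa v)
        ((pa v).restrict (fun v => Classical.arbitrary (I v))) m, fun m => hmeas v _ m hv, ?_⟩
      filter_upwards [hp.sum_eq_one] with ω hω m
      rw [condProb_eq, joint_empty _ _ h0, marginal_empty _ h0, hω, div_one]
    · obtain ⟨Y, hY, hYe⟩ := ih (rank u) (hr ▸ hlt) u (hlt.trans hv) rfl
      -- The coordinates other than u are arbitrary: the parent set {u} does not see them.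
      let c : I u → (a : pa v) → I a := fun k =>
        (pa v).restrict (Function.update (fun v => Classical.arbitrary (I v)) u k)
      refine ⟨fun m ω => ∑ k, Y k ω * condProb (p ω) v (pa v) (c k) m, fun m => ?_, ?_⟩
      · exact Finset.measurable_fun_sum _ fun k _ => (hY k).mul (hmeas v _ m hv)
      · filter_upwards [hYe, hp.pos] with ω hω hpos m
        rw [← sum_pair_left (p ω) u v m]
        refine Finset.sum_congr rfl fun k _ => ?_
        rw [hω k, condProb_eq, joint_of_eq_singleton _ _ hu, marginal_of_eq_singleton _ hu,
          Function.update_self, mul_div_cancel₀ _ (vert_pos hpos u k).ne']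

/-- The moments of the two-way table of a vertex and its parent. -/
theorem ParameterIndependence.integral_pair {pa : V → Finset V}
    (h : ParameterIndependence μ p pa) (hp : IsRandomProbability μ p) (rank : V → ℕ)
    (hpa : ∀ v, pa v = ∅ ∨ ∃ u, pa v = {u} ∧ rank u < rank v) {u v : V} (huv : pa v = {u})
    (r : I u × I v → ℕ) :
    ∫ ω, ∏ q, pair (p ω) u v q.1 q.2 ^ r q ∂μ =
      (∫ ω, ∏ k, vert (p ω) u k ^ (∑ m, r (k, m)) ∂μ) *
        ∏ k, ∫ ω, ∏ m, (pair (p ω) u v k m / vert (p ω) u k) ^ r (k, m) ∂μ := by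
  have hlt : rank u < rank v := by
    rcases hpa v with h0 | ⟨w, hw, hlt⟩
    · rw [h0] at huv
      exact absurd huv.symm (Finset.singleton_ne_empty u)
    · rw [huv, Finset.singleton_inj] at hw
      rwa [hw]
  obtain ⟨Y, hY, hYe⟩ := exists_measurable_vert (μ := μ) hp rank hpa (rank v) u hlt
  let c : I u → (a : pa v) → I a := fun k =>
    (pa v).restrict (Function.update (fun v => Classical.arbitrary (I v)) u k)
  have hc : ∀ ω k m, condProb (p ω) v (pa v) (c k) m =
      pair (p ω) u v k m / vert (p ω) u k := by
    intro ω k m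
    rw [condProb_eq, joint_of_eq_singleton _ _ huv, marginal_of_eq_singleton _ huv,
      Function.update_self]
  have hcinj : Function.Injective fun k => (⟨v, c k⟩ : Σ v : V, ((a : pa v) → I a)) := by
    intro k k' hk
    have h1 : c k = c k' := eq_of_heq (Sigma.mk.inj hk).2
    simpa using (restrict_eq_iff_of_eq_singleton huv _ _).1 h1
  have hle : ∀ s : Σ v : V, ((a : pa v) → I a),
      MeasurableSpace.comap (fun ω (m : I s.1) => condProb (p ω) s.1 (pa s.1) s.2 m)
        inferInstance ≤ ‹MeasurableSpace Ω› :=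
    fun s => (hp.measurable_condProb_vec s.1 _ s.2).comap_le
  -- The marginal of u uses parameters of rank below v only, hence is independent of the parameters
  -- at v.
  have hdisj : Disjoint {s : Σ v : V, ((a : pa v) → I a) | rank s.1 < rank v}
      {s : Σ v : V, ((a : pa v) → I a) | s.1 = v} := by
    rw [Set.disjoint_left]
    rintro s hs hs'
    rw [Set.mem_ofPred_eq] at hs hs'
    rw [hs'] at hs
    exact lt_irrefl _ hs
  have hindep := indep_iSup_of_disjoint hle h.indep.iIndep hdisj
  -- `A` uses the version `Y` of the marginal of u: it is measurable for the σ-algebra of the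
  -- earlier parameters, while the marginal itself equals it only almost surely.
  let A : Ω → ℝ := fun ω => ∏ k, Y k ω ^ (∑ m, r (k, m))
  let B : Ω → ℝ := fun ω => ∏ k, ∏ m, condProb (p ω) v (pa v) (c k) m ^ r (k, m)
  have hA := Finset.measurable_fun_prod (s := Finset.univ) fun k _ =>
    (hY k).pow_const (∑ m, r (k, m))
  have hB : Measurable[⨆ s ∈ {s : Σ v : V, ((a : pa v) → I a) | s.1 = v},
        MeasurableSpace.comap (fun ω (m : I s.1) => condProb (p ω) s.1 (pa s.1) s.2 m)
          inferInstance] B := by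
    refine Finset.measurable_fun_prod _ fun k _ => Finset.measurable_fun_prod _ fun m _ =>
      Measurable.pow_const ?_ _
    have h1 : Measurable[MeasurableSpace.comap
        (fun ω (m : I v) => condProb (p ω) v (pa v) (c k) m)
        inferInstance] (fun ω (m : I v) => condProb (p ω) v (pa v) (c k) m) :=
      comap_measurable _
    refine ((measurable_pi_apply m).comp h1).mono ?_ le_rfl
    exact le_iSup₂_of_le (f := fun (s : Σ v : V, ((a : pa v) → I a))
      (_ : s ∈ {s : Σ v : V, ((a : pa v) → I a) | s.1 = v}) =>
        MeasurableSpace.comap (fun ω (m : I s.1) => condProb (p ω) s.1 (pa s.1) s.2 m)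
          inferInstance) ⟨v, c k⟩ rfl le_rfl
  have hAB : A ⟂ᵢ[μ] B := by
    rw [IndepFun_iff_Indep]
    exact indep_of_indep_of_le hindep hA.comap_le hB.comap_le
  have hAm : Measurable A := hA.mono (iSup₂_le fun s _ => hle s) le_rfl
  have hBm : Measurable B := hB.mono (iSup₂_le fun s _ => hle s) le_rfl
  have hprod := hAB.integral_fun_mul_eq_mul_integral hAm.aestronglyMeasurable
    hBm.aestronglyMeasurable
  have hBi : ∫ ω, B ω ∂μ = ∏ k, ∫ ω, ∏ m, condProb (p ω) v (pa v) (c k) m ^ r (k, m) ∂μ := by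
    refine iIndepFun.integral_fun_prod_comp (𝕜 := ℝ)
      (f := fun k (b : I v → ℝ) => ∏ m, b m ^ r (k, m))
      (h.indep.precomp hcinj)
      (fun k => (hp.measurable_condProb_vec v _ (c k)).aemeasurable) fun k => ?_
    exact Measurable.aestronglyMeasurable (by fun_prop)
  have hl : ∫ ω, ∏ q, pair (p ω) u v q.1 q.2 ^ r q ∂μ = ∫ ω, A ω * B ω ∂μ := by
    refine integral_congr_ae ?_
    filter_upwards [hYe, hp.pos] with ω hω hpos
    simp only [A, B]
    rw [Fintype.prod_prod_type, ← Finset.prod_mul_distrib]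
    refine Finset.prod_congr rfl fun k _ => ?_
    rw [hω k, ← Finset.prod_pow_eq_pow_sum, ← Finset.prod_mul_distrib]
    refine Finset.prod_congr rfl fun m _ => ?_
    rw [hc, ← mul_pow, mul_div_cancel₀ _ (vert_pos hpos u k).ne']
  rw [hl, hprod, hBi]
  congr 1
  · refine integral_congr_ae ?_
    filter_upwards [hYe] with ω hω
    simp only [A, hω]
  · simp only [hc]

end Moments

/-! ### Row moments of a two-way Pólya urn -/

/-- If the moments of a two-way table are those of a Pólya urn and factorize along rows, then the
row totals and the normalized rows have the moments of Pólya urns as well. -/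
theorem polya_row_moments {K L : Type*} [Fintype K] [DecidableEq K] [Fintype L] [DecidableEq L]
    [Nonempty L] (M : (K × L → ℕ) → ℝ) (f : (K → ℕ) → ℝ) (F : K → (L → ℕ) → ℝ)
    (hf : ∀ ρ, 0 < f ρ) (hF : ∀ k s, 0 < F k s)
    (hFsum : ∀ k s, ∑ l, F k (s + Pi.single l 1) = F k s)
    (hrow : ∀ r, M r = f (fun k => ∑ l, r (k, l)) * ∏ k, F k (fun l => r (k, l)))
    {c : ℝ} (a : K × L → ℝ) (hM : ∀ r i, M (r + Pi.single i 1) * (1 + c * (∑ k, r k : ℕ)) =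
      M r * (a i + c * r i)) :
    (∀ ρ k, f (ρ + Pi.single k 1) * (1 + c * (∑ k, ρ k : ℕ)) =
      f ρ * (∑ l, a (k, l) + c * ρ k)) ∧
    ∀ k s l, F k (s + Pi.single l 1) * (∑ l, a (k, l) + c * (∑ l, s l : ℕ)) =
      F k s * (a (k, l) + c * s l) := by
  have key : ∀ (r : K × L → ℕ) k l, M (r + Pi.single (k, l) 1) =
      f ((fun k => ∑ l, r (k, l)) + Pi.single k 1) *
        (F k ((fun l => r (k, l)) + Pi.single l 1) *
          ∏ k' ∈ Finset.univ.erase k, F k' (fun l => r (k', l))) := by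
    intro r k l
    rw [hrow, ← Finset.mul_prod_erase _ _ (Finset.mem_univ k)]
    congr 2
    · funext k'
      rcases eq_or_ne k' k with rfl | h
      · simp [Finset.sum_add_distrib, Pi.single_apply]
      · simp [h]
    · congr 1
      funext l'
      simp [Pi.single_apply]
    · refine Finset.prod_congr rfl fun k' hk' => ?_
      congr 1
      funext l'
      simp [Finset.ne_of_mem_erase hk']
  have key0 : ∀ (r : K × L → ℕ) k, M r = f (fun k => ∑ l, r (k, l)) *
        (F k (fun l => r (k, l)) * ∏ k' ∈ Finset.univ.erase k, F k' (fun l => r (k', l))) := by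
    intro r k
    rw [hrow, ← Finset.mul_prod_erase _ _ (Finset.mem_univ k)]
  have hP : ∀ (r : K × L → ℕ) k,
      0 < ∏ k' ∈ Finset.univ.erase k, F k' (fun l => r (k', l)) :=
    fun r k => Finset.prod_pos fun k' _ => hF k' _
  have h1 : ∀ ρ k, f (ρ + Pi.single k 1) * (1 + c * (∑ k, ρ k : ℕ)) =
      f ρ * (∑ l, a (k, l) + c * ρ k) := by
    intro ρ k
    let l₀ : L := Classical.arbitrary L
    -- Any table with row totals ρ would do. Summing the urn rule along row k and using `hFsum`
    -- leaves a relation for `f` alone.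
    let r : K × L → ℕ := fun q => if q.2 = l₀ then ρ q.1 else 0
    have hr : (fun k => ∑ l, r (k, l)) = ρ := by
      funext k
      simp [r]
    have hr' : ∑ q, r q = ∑ k, ρ k := by simp [r, Fintype.sum_prod_type]
    have h := Finset.sum_congr (rfl : (Finset.univ : Finset L) = Finset.univ)
      fun l _ => hM r (k, l)
    rw [← Finset.sum_mul, ← Finset.mul_sum, Finset.sum_add_distrib, ← Finset.mul_sum,
      ← Nat.cast_sum, show ∑ l, r (k, l) = ρ k from congrFun hr k, key0 r k, hr'] at h
    simp only [key, hr] at h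
    rw [← Finset.mul_sum, ← Finset.sum_mul, hFsum] at h
    refine mul_right_cancel₀ (mul_pos (hF k fun l => r (k, l)) (hP r k)).ne' ?_
    linear_combination h
  refine ⟨h1, fun k s l => ?_⟩
  -- With all the mass in row k, the rule for `f` just proved cancels from the rule for M and leaves
  -- the one for `F k`.
  let r : K × L → ℕ := fun q => if q.1 = k then s q.2 else 0
  have hr : (fun k => ∑ l, r (k, l)) = Pi.single k (∑ l, s l) := by
    funext k'
    rcases eq_or_ne k' k with rfl | h
    · simp [r]
    · simp [r, h]
  have hr' : ∑ q, r q = ∑ l, s l := by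
    rw [Fintype.sum_prod_type]
    have := congrArg (fun g => ∑ k, g k) hr
    simpa using this
  have hrs : (fun l => r (k, l)) = s := by simp [r]
  have h2 := hM r (k, l)
  have h3 := h1 (Pi.single k (∑ l, s l)) k
  rw [key, key0 r k, hr, hr', hrs, show r (k, l) = s l from congrFun hrs l] at h2
  simp only [Finset.sum_pi_single', Finset.mem_univ, if_true, Pi.single_eq_same] at h3
  refine mul_left_cancel₀ (hf (Pi.single k (∑ l, s l))).ne' ?_
  refine mul_right_cancel₀ (hP r k).ne' ?_
  linear_combination h2 - (F k (s + Pi.single l 1) *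
    ∏ k' ∈ Finset.univ.erase k, F k' (fun l => r (k', l))) * h3

/-! ### Moments of bounded positive vectors -/

section Bounded

variable {Ω : Type*} [MeasurableSpace Ω] {μ : Measure Ω} [IsProbabilityMeasure μ]
  {ι : Type*} [Fintype ι] {q : Ω → ι → ℝ}

theorem integrable_monomial (hq : ∀ i, Measurable fun ω => q ω i) (hpos : ∀ᵐ ω ∂μ, ∀ i, 0 < q ω i)
    (hsum : ∀ᵐ ω ∂μ, ∑ i, q ω i = 1) (r : ι → ℕ) :
    Integrable (fun ω => ∏ i, q ω i ^ r i) μ := by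
  refine Integrable.of_bound (C := 1) ?_ ?_
  · exact (Finset.measurable_fun_prod _ fun i _ => (hq i).pow_const _).aestronglyMeasurable
  · filter_upwards [hpos, hsum] with ω h1 h2
    rw [Real.norm_of_nonneg (Finset.prod_nonneg fun i _ => pow_nonneg (h1 i).le _)]
    refine Finset.prod_le_one (fun i _ => pow_nonneg (h1 i).le _) fun i _ =>
      pow_le_one₀ (h1 i).le ?_
    rw [← h2]
    exact Finset.single_le_sum (fun j _ => (h1 j).le) (Finset.mem_univ i)

theorem integral_monomial_pos (hq : ∀ i, Measurable fun ω => q ω i)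
    (hpos : ∀ᵐ ω ∂μ, ∀ i, 0 < q ω i) (hsum : ∀ᵐ ω ∂μ, ∑ i, q ω i = 1) (r : ι → ℕ) :
    0 < ∫ ω, ∏ i, q ω i ^ r i ∂μ := by
  have hp : ∀ᵐ ω ∂μ, 0 < ∏ i, q ω i ^ r i := by
    filter_upwards [hpos] with ω h
    exact Finset.prod_pos fun i _ => pow_pos (h i) _
  have h0 : 0 ≤ ∫ ω, ∏ i, q ω i ^ r i ∂μ :=
    integral_nonneg_of_ae (hp.mono fun ω h => h.le)
  refine lt_of_le_of_ne h0 fun h => ?_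
  have h1 := (integral_eq_zero_iff_of_nonneg_ae (hp.mono fun ω h => h.le)
    (integrable_monomial hq hpos hsum r)).1 h.symm
  obtain ⟨ω, hω, hω'⟩ := (hp.and h1).exists
  exact hω.ne' hω'

theorem prod_pow_add_single [DecidableEq ι] (x : ι → ℝ) (r : ι → ℕ) (i : ι) :
    ∏ j, x j ^ (r + Pi.single i 1 : ι → ℕ) j = (∏ j, x j ^ r j) * x i := by
  simp only [Pi.add_apply, pow_add, Finset.prod_mul_distrib]
  congr 1
  rw [Finset.prod_eq_single i (fun j _ hj => by simp [hj]) (by simp)]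
  simp

theorem prod_pow_single [DecidableEq ι] (x : ι → ℝ) (i : ι) :
    ∏ j, x j ^ (Pi.single i 1 : ι → ℕ) j = x i := by
  have := prod_pow_add_single x 0 i
  simpa using this

theorem sum_integral_monomial [DecidableEq ι] (hq : ∀ i, Measurable fun ω => q ω i)
    (hpos : ∀ᵐ ω ∂μ, ∀ i, 0 < q ω i) (hsum : ∀ᵐ ω ∂μ, ∑ i, q ω i = 1) (r : ι → ℕ) :
    ∑ i, ∫ ω, ∏ j, q ω j ^ (r + Pi.single i 1 : ι → ℕ) j ∂μ = ∫ ω, ∏ i, q ω i ^ r i ∂μ := by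
  rw [← integral_finsetSum _ fun i _ => integrable_monomial hq hpos hsum _]
  refine integral_congr_ae ?_
  filter_upwards [hsum] with ω h
  simp only [prod_pow_add_single]
  rw [← Finset.mul_sum, h, mul_one]

/-- The moment identity says that the variance vanishes. This is what excludes a urn without
reinforcement. -/
theorem ae_eq_const_of_integral_sq {X : Ω → ℝ} (hX : Measurable X) (h0 : ∀ᵐ ω ∂μ, 0 ≤ X ω)
    (h1 : ∀ᵐ ω ∂μ, X ω ≤ 1) (h : ∫ ω, X ω * X ω ∂μ = (∫ ω, X ω ∂μ) * ∫ ω, X ω ∂μ) :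
    ∀ᵐ ω ∂μ, X ω = ∫ ω, X ω ∂μ := by
  have hL : MemLp X 2 μ := by
    refine MemLp.of_bound hX.aestronglyMeasurable 1 ?_
    filter_upwards [h0, h1] with ω a b
    rwa [Real.norm_of_nonneg a]
  refine ae_eq_integral_of_variance_eq_zero hL ?_
  rw [variance_eq_sub hL]
  have : X ^ 2 = fun ω => X ω * X ω := by
    funext ω
    simp [sq]
  rw [this, h]
  ring

end Bounded

/-! ### Moments of the full table -/

section Full

variable {V : Type*} [Fintype V] [DecidableEq V] {I : V → Type*} [∀ v, Fintype (I v)]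
  [∀ v, DecidableEq (I v)] {Ω : Type*} [MeasurableSpace Ω] {μ : Measure Ω}
  {p : Ω → ((v : V) → I v) → ℝ}

/-- The moments of a vector of conditional probabilities. -/
def condMoment (μ : Measure Ω) (p : Ω → ((v : V) → I v) → ℝ) (v : V) (A : Finset V)
    (k : (a : A) → I a) (t : I v → ℕ) : ℝ :=
  ∫ ω, ∏ m, condProb (p ω) v A k m ^ t m ∂μ

/-- Grouping the cells by parent configuration and by value turns the exponents into joint counts;
joint independence then splits the expectation. -/
theorem ParameterIndependence.integral_table {pa : V → Finset V}
    (h : ParameterIndependence μ p pa) (hp : IsRandomProbability μ p)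
    (hfac : ∀ᵐ ω ∂μ, ∀ i, p ω i = ∏ v, condProb (p ω) v (pa v) ((pa v).restrict i) (i v))
    (r : ((v : V) → I v) → ℕ) :
    ∫ ω, ∏ i, p ω i ^ r i ∂μ =
      ∏ v, ∏ k, condMoment μ p v (pa v) k (joint r v (pa v) k) := by
  have h1 : ∫ ω, ∏ i, p ω i ^ r i ∂μ = ∫ ω, ∏ s : Σ v : V, ((a : pa v) → I a),
      ∏ m, condProb (p ω) s.1 (pa s.1) s.2 m ^ joint r s.1 (pa s.1) s.2 m ∂μ := by
    refine integral_congr_ae ?_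
    filter_upwards [hfac] with ω hω
    rw [Fintype.prod_sigma]
    rw [Finset.prod_congr rfl fun i _ => by rw [hω i, ← Finset.prod_pow], Finset.prod_comm]
    refine Finset.prod_congr rfl fun v _ => ?_
    rw [← Finset.prod_fiberwise _ (fun i : (v : V) → I v => (pa v).restrict i)]
    refine Finset.prod_congr rfl fun k _ => ?_
    rw [← Finset.prod_fiberwise _ (fun i : (v : V) → I v => i v)]
    refine Finset.prod_congr rfl fun m _ => ?_
    rw [joint, ← Finset.prod_pow_eq_pow_sum, Finset.filter_filter]
    refine Finset.prod_congr rfl fun i hi => ?_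
    have hi' : (pa v).restrict i = k ∧ i v = m := (Finset.mem_filter.1 hi).2
    rw [hi'.1, hi'.2]
  rw [h1, ← Fintype.prod_sigma' (fun v k => condMoment μ p v (pa v) k (joint r v (pa v) k))]
  exact iIndepFun.integral_fun_prod_comp (𝕜 := ℝ)
    (f := fun (s : Σ v : V, ((a : pa v) → I a)) (b : I s.1 → ℝ) =>
      ∏ m, b m ^ joint r s.1 (pa s.1) s.2 m) h.indep
    (fun s => (hp.measurable_condProb_vec s.1 _ s.2).aemeasurable)
    fun s => Measurable.aestronglyMeasurable (by fun_prop)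

theorem joint_add_single (r : ((v : V) → I v) → ℕ) (i : (v : V) → I v) (v : V) (A : Finset V) :
    joint (r + Pi.single i 1) v A (A.restrict i) =
      joint r v A (A.restrict i) + Pi.single (i v) 1 := by
  funext m
  simp only [joint, Pi.add_apply, Finset.sum_add_distrib, Finset.sum_filter, add_right_inj]
  rw [Finset.sum_eq_single i (fun j _ hj => by simp [hj]) (by simp)]
  simp [Pi.single_apply, eq_comm]

theorem joint_add_single_of_ne (r : ((v : V) → I v) → ℕ) (i : (v : V) → I v) (v : V)
    (A : Finset V) (k : (a : A) → I a) (hk : k ≠ A.restrict i) :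
    joint (r + Pi.single i 1) v A k = joint r v A k := by
  funext m
  refine Finset.sum_congr rfl fun j hj => ?_
  have : j ≠ i := by
    rintro rfl
    exact hk (Finset.mem_filter.1 hj).2.1.symm
  simp [this]

/-- If every vector of conditional probabilities has Dirichlet moments, then adding an observation
multiplies the moment of the table by the predictive probability. -/
theorem ParameterIndependence.integral_table_add_single [∀ v, Nonempty (I v)]
    {pa : V → Finset V}
    (h : ParameterIndependence μ p pa) (hp : IsRandomProbability μ p)
    (hfac : ∀ᵐ ω ∂μ, ∀ i, p ω i = ∏ v, condProb (p ω) v (pa v) ((pa v).restrict i) (i v))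
    (a : ((v : V) → I v) → ℝ) (ha : ∀ i, 0 < a i)
    (hΦ : ∀ v i t, condMoment μ p v (pa v) ((pa v).restrict i) (t + Pi.single (i v) 1) *
        (marginal a (pa v) ((pa v).restrict i) + (∑ m, t m : ℕ)) =
      condMoment μ p v (pa v) ((pa v).restrict i) t *
        (joint a v (pa v) ((pa v).restrict i) (i v) + t (i v)))
    (r : ((v : V) → I v) → ℕ) (i : (v : V) → I v) :
    ∫ ω, ∏ j, p ω j ^ (r + Pi.single i 1 : ((v : V) → I v) → ℕ) j ∂μ =
      (∫ ω, ∏ j, p ω j ^ r j ∂μ) *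
        ∏ v, condProb (fun j => a j + r j) v (pa v) ((pa v).restrict i) (i v) := by
  rw [h.integral_table hp hfac, h.integral_table hp hfac, ← Finset.prod_mul_distrib]
  refine Finset.prod_congr rfl fun v _ => ?_
  rw [← Finset.mul_prod_erase _ _ (Finset.mem_univ ((pa v).restrict i)),
    ← Finset.mul_prod_erase (a := (pa v).restrict i) _ _ (Finset.mem_univ _), mul_right_comm]
  congr 1
  · rw [joint_add_single, condProb_eq, mul_div_assoc']
    have hj : joint (fun j => a j + (r j : ℝ)) v (pa v) ((pa v).restrict i) (i v) =
        joint a v (pa v) ((pa v).restrict i) (i v) + joint r v (pa v) ((pa v).restrict i) (i v) := by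
      simp [joint, Finset.sum_add_distrib]
    have hm : marginal (fun j => a j + (r j : ℝ)) (pa v) ((pa v).restrict i) =
        marginal a (pa v) ((pa v).restrict i) +
          (∑ m, joint r v (pa v) ((pa v).restrict i) m : ℕ) := by
      rw [sum_joint]
      simp [marginal, Finset.sum_add_distrib]
    have hpos : 0 < marginal (fun j => a j + (r j : ℝ)) (pa v) ((pa v).restrict i) :=
      marginal_pos (fun j => add_pos_of_pos_of_nonneg (ha j) (Nat.cast_nonneg _)) _ _
    rw [eq_div_iff hpos.ne', hj, hm]
    exact hΦ v i _
  · refine Finset.prod_congr rfl fun k hk => ?_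
    rw [joint_add_single_of_ne _ _ _ _ _ (Finset.ne_of_mem_erase hk)]

/-! ### The normalizing constant -/

theorem marginal_add_single (x : ((v : V) → I v) → ℝ) (i : (v : V) → I v) (A : Finset V)
    (k : (a : A) → I a) :
    marginal (x + Pi.single i 1) A k = marginal x A k + if k = A.restrict i then 1 else 0 := by
  simp only [marginal, Pi.add_apply, Finset.sum_add_distrib, Finset.sum_filter, add_right_inj]
  rw [Finset.sum_eq_single i (fun j _ hj => by simp [hj]) (by simp)]
  simp [eq_comm]

/-- Only the marginal cell containing i changes, by 1, and Γ(t+1) = tΓ(t) applies there. -/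
theorem prod_Gamma_marginal_add_single [∀ v, Nonempty (I v)] (x : ((v : V) → I v) → ℝ)
    (hx : ∀ i, 0 < x i) (i : (v : V) → I v) (A : Finset V) :
    ∏ k, Real.Gamma (marginal (x + Pi.single i 1) A k) =
      marginal x A (A.restrict i) * ∏ k, Real.Gamma (marginal x A k) := by
  rw [← Finset.mul_prod_erase _ _ (Finset.mem_univ (A.restrict i)),
    ← Finset.mul_prod_erase (a := A.restrict i) _ _ (Finset.mem_univ _), ← mul_assoc]
  congr 1
  · rw [marginal_add_single, if_pos rfl, Real.Gamma_add_one (marginal_pos hx _ _).ne']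
  · refine Finset.prod_congr rfl fun k hk => ?_
    rw [marginal_add_single, if_neg (Finset.ne_of_mem_erase hk), add_zero]

theorem normConst_marginal_add_single [∀ v, Nonempty (I v)] {K : ℕ} (C : Fin K → Finset V)
    (x : ((v : V) → I v) → ℝ) (hx : ∀ i, 0 < x i) (i : (v : V) → I v) :
    normConst C (marginal (x + Pi.single i 1)) = normConst C (marginal x) *
      ((∏ l, marginal x (C l) ((C l).restrict i)) /
        ∏ l, marginal x (separator C l) ((separator C l).restrict i)) := by
  simp only [normConst, prod_Gamma_marginal_add_single x hx, Finset.prod_mul_distrib]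
  rw [mul_div_mul_comm, mul_comm]

theorem normConst_marginal_pos [∀ v, Nonempty (I v)] {K : ℕ} (C : Fin K → Finset V)
    (x : ((v : V) → I v) → ℝ) (hx : ∀ i, 0 < x i) : 0 < normConst C (marginal x) :=
  div_pos
    (Finset.prod_pos fun _ _ => Finset.prod_pos fun _ _ => Real.Gamma_pos_of_pos
      (marginal_pos hx _ _))
    (Finset.prod_pos fun _ _ => Finset.prod_pos fun _ _ => Real.Gamma_pos_of_pos
      (marginal_pos hx _ _))

/-- Consistency is automatic once all parameters are margins of one positive table, since margins of
margins are margins. -/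
theorem isHyperParameter_marginal [∀ v, Nonempty (I v)] {K : ℕ} (C : Fin K → Finset V)
    (x : ((v : V) → I v) → ℝ) (hx : ∀ i, 0 < x i) : IsHyperParameter C (marginal x) where
  clique_pos _ _ := marginal_pos hx _ _
  separator_pos _ _ := marginal_pos hx _ _
  consistent l m h n := by
    simp only [marginal]
    rw [← Finset.sum_fiberwise_of_maps_to (s := Finset.univ.filter fun i => _)
      (t := Finset.univ.filter fun k : (a : C m) → I a => Finset.restrict₂ (π := I) h k = n)
      (g := fun i : (v : V) → I v => (C m).restrict i)]
    · refine Finset.sum_congr rfl fun k hk => ?_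
      rw [Finset.filter_filter]
      refine Finset.sum_congr ?_ fun _ _ => rfl
      ext i
      simp only [Finset.mem_filter, Finset.mem_univ, true_and] at hk ⊢
      constructor
      · exact fun h => h.2
      · rintro rfl
        exact ⟨hk, rfl⟩
    · intro i hi
      simp only [Finset.mem_filter, Finset.mem_univ, true_and] at hi ⊢
      exact hi

end Full

/-! ### Perfect clique orders of the chain -/

/-- The edges of the chain. -/
def chainEdge {n : ℕ} (j : Fin (n + 1)) : Finset (Fin (n + 2)) := {j.castSucc, j.succ}

theorem card_chainEdge {n : ℕ} (j : Fin (n + 1)) : (chainEdge j).card = 2 :=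
  Finset.card_pair (Fin.castSucc_lt_succ).ne

theorem chainEdge_injective {n : ℕ} : Function.Injective (chainEdge (n := n)) := by
  intro j k h
  have h1 : j.castSucc ∈ chainEdge k := by rw [← h]; simp [chainEdge]
  have h2 : j.succ ∈ chainEdge k := by rw [← h]; simp [chainEdge]
  simp only [chainEdge, Finset.mem_insert, Finset.mem_singleton, Fin.ext_iff, Fin.val_castSucc,
    Fin.val_succ] at h1 h2 ⊢
  omega

theorem isClique_chainEdge {n : ℕ} (j : Fin (n + 1)) :
    (SimpleGraph.pathGraph (n + 2)).IsClique (chainEdge j : Set (Fin (n + 2))) := by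
  intro a ha b hb hab
  rw [SimpleGraph.pathGraph_adj]
  simp only [chainEdge, Finset.coe_insert, Finset.coe_singleton, Set.mem_insert_iff,
    Set.mem_singleton_iff, Fin.ext_iff, Fin.val_castSucc, Fin.val_succ] at ha hb
  have := Fin.val_ne_of_ne hab
  omega

theorem exists_subset_chainEdge {n : ℕ} {A : Finset (Fin (n + 2))}
    (hA : (SimpleGraph.pathGraph (n + 2)).IsClique (A : Set (Fin (n + 2)))) :
    ∃ j, A ⊆ chainEdge j := by
  rcases A.eq_empty_or_nonempty with rfl | hne
  · exact ⟨0, Finset.empty_subset _⟩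
  -- The cap at n matters when A consists of the last vertex n + 1 alone, which starts no edge.
  · refine ⟨⟨min (A.min' hne).val n, by omega⟩, fun y hy => ?_⟩
    have h1 : (A.min' hne).val ≤ y.val := A.min'_le y hy
    have h2 : A.min' hne = y ∨ (SimpleGraph.pathGraph (n + 2)).Adj (A.min' hne) y := by
      by_cases h : A.min' hne = y
      · exact Or.inl h
      · exact Or.inr (hA (A.min'_mem hne) hy h)
    rw [SimpleGraph.pathGraph_adj, Fin.ext_iff] at h2
    have := y.isLt
    simp only [chainEdge, Finset.mem_insert, Finset.mem_singleton, Fin.ext_iff, Fin.val_castSucc,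
      Fin.val_succ]
    omega

theorem maximal_isClique_pathGraph_iff {n : ℕ} (D : Finset (Fin (n + 2))) :
    Maximal (fun A : Finset (Fin (n + 2)) =>
      (SimpleGraph.pathGraph (n + 2)).IsClique (A : Set (Fin (n + 2)))) D ↔
      ∃ j, chainEdge j = D := by
  constructor
  · intro h
    obtain ⟨j, hj⟩ := exists_subset_chainEdge h.prop
    exact ⟨j, le_antisymm (h.le_of_ge (isClique_chainEdge j) hj) hj⟩
  · rintro ⟨j, rfl⟩
    refine ⟨isClique_chainEdge j, fun A hA hjA => ?_⟩
    obtain ⟨k, hk⟩ := exists_subset_chainEdge hA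
    have : chainEdge j = chainEdge k :=
      Finset.eq_of_subset_of_card_le (hjA.trans hk) (by simp [card_chainEdge])
    rw [this]
    exact hk

/-- Every vertex belongs to one separator fewer than cliques. -/
theorem prod_separator_mul_prod {V : Type*} [Fintype V] [DecidableEq V] {M : Type*} [CommMonoid M]
    {K : ℕ} (C : Fin K → Finset V) (hC : ∀ v, ∃ l, v ∈ C l) (g : V → M) :
    (∏ l, ∏ v ∈ separator C l, g v) * ∏ v, g v = ∏ l, ∏ v ∈ C l, g v := by
  have h : ∀ S : Fin K → Finset V, ∏ l, ∏ v ∈ S l, g v =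
      ∏ v, g v ^ (Finset.univ.filter fun l => v ∈ S l).card := by
    intro S
    rw [Finset.prod_comm' (t' := Finset.univ) (s' := fun v => Finset.univ.filter fun l => v ∈ S l)
      (by simp)]
    simp
  rw [h, h, ← Finset.prod_mul_distrib]
  refine Finset.prod_congr rfl fun v _ => ?_
  rw [← pow_succ]
  congr 1
  have hne : (Finset.univ.filter fun l => v ∈ C l).Nonempty := by
    obtain ⟨l, hl⟩ := hC v
    exact ⟨l, by simpa using hl⟩
  -- Among the sets containing v, exactly the earliest has a separator that omits v.
  have hmem := Finset.min'_mem _ hne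
  rw [← Finset.card_erase_add_one hmem]
  congr 2
  ext l
  simp only [separator, Finset.mem_filter, Finset.mem_univ, true_and, Finset.mem_inter,
    Finset.mem_biUnion, Finset.mem_Iio, Finset.mem_erase]
  constructor
  · rintro ⟨h1, i, hi, hvi⟩
    refine ⟨fun hl => ?_, h1⟩
    have := Finset.min'_le _ i (by simpa using hvi : i ∈ Finset.univ.filter fun l => v ∈ C l)
    rw [← hl] at this
    exact absurd hi (not_lt.2 this)
  · rintro ⟨h1, h2⟩
    refine ⟨h2, _, lt_of_le_of_ne (Finset.min'_le _ l (by simpa using h2)) (Ne.symm h1), ?_⟩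
    simpa using hmem

theorem IsPerfectCliqueOrder.exists_equiv_chainEdge {n K : ℕ} {C : Fin K → Finset (Fin (n + 2))}
    (hC : IsPerfectCliqueOrder (SimpleGraph.pathGraph (n + 2)) C) :
    ∃ e : Fin (n + 1) ≃ Fin K, ∀ j, C (e j) = chainEdge j := by
  have h : ∀ j, ∃ l, C l = chainEdge j := fun j =>
    (hC.mem_range _).2 ((maximal_isClique_pathGraph_iff _).2 ⟨j, rfl⟩)
  choose e he using h
  refine ⟨Equiv.ofBijective e ⟨fun j k hjk => ?_, fun l => ?_⟩, he⟩
  · apply chainEdge_injective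
    rw [← he, ← he, hjk]
  · obtain ⟨j, hj⟩ := (maximal_isClique_pathGraph_iff _).1 ((hC.mem_range (C l)).1 ⟨l, rfl⟩)
    exact ⟨j, hC.injective (by rw [he, hj])⟩

theorem separator_zero {V : Type*} [DecidableEq V] {K : ℕ} (C : Fin (K + 1) → Finset V) :
    separator C 0 = ∅ := by
  have h : Finset.Iio (0 : Fin (K + 1)) = ∅ := by
    ext l
    simp
  rw [separator, h, Finset.biUnion_empty, Finset.inter_empty]

/-- A separator of size 2 would make its edge equal to an earlier one, so sizes are at most 1.
Counting vertex incidences gives total size n over n separators, so each size is 1. -/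
theorem IsPerfectCliqueOrder.card_separator_succ {n : ℕ}
    {C : Fin (n + 1) → Finset (Fin (n + 2))}
    (hC : IsPerfectCliqueOrder (SimpleGraph.pathGraph (n + 2)) C)
    {e : Fin (n + 1) ≃ Fin (n + 1)} (he : ∀ j, C (e j) = chainEdge j) (l : Fin n) :
    (separator C l.succ).card = 1 := by
  have hcard : ∀ l, (C l).card = 2 := fun l => by
    rw [← e.apply_symm_apply l, he, card_chainEdge]
  have hle : ∀ l : Fin n, (separator C l.succ).card ≤ 1 := by
    intro l
    by_contra h
    push Not at h
    obtain ⟨i, hi, hsub⟩ := hC.running l.succ (by simp)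
    have h1 : separator C l.succ = C l.succ :=
      Finset.eq_of_subset_of_card_le Finset.inter_subset_left (by rw [hcard]; exact h)
    have h2 : separator C l.succ = C i :=
      Finset.eq_of_subset_of_card_le hsub (by rw [hcard]; exact h)
    exact hi.ne (hC.injective (h2.symm.trans h1))
  have hcov : ∀ v, ∃ l, v ∈ C l := by
    intro v
    induction v using Fin.cases with
    | zero => exact ⟨e 0, by rw [he]; simp [chainEdge]⟩
    | succ j => exact ⟨e j, by rw [he]; simp [chainEdge]⟩
  -- Giving every vertex the weight 2 moves the count into exponents of 2, which can be compared.
  have h := prod_separator_mul_prod C hcov (fun _ => 2)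
  simp only [Finset.prod_const, hcard, Finset.prod_pow_eq_pow_sum, Finset.card_univ,
    Fintype.card_fin] at h
  rw [← pow_mul, ← pow_add] at h
  have h := Nat.pow_right_injective le_rfl h
  rw [Fin.sum_univ_succ, separator_zero, Finset.card_empty] at h
  have hsum : ∑ l : Fin n, (separator C l.succ).card = ∑ l : Fin n, 1 := by
    simp only [Finset.sum_const, Finset.card_univ, Fintype.card_fin, smul_eq_mul, mul_one]
    omega
  exact (Finset.sum_eq_sum_iff_of_le fun l _ => hle l).1 hsum l (Finset.mem_univ l)

theorem forwardParents_zero (n : ℕ) : forwardParents (n + 2) 0 = ∅ := by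
  ext i
  simp [forwardParents]

theorem forwardParents_succ {n : ℕ} (j : Fin (n + 1)) :
    forwardParents (n + 2) j.succ = {j.castSucc} := by
  ext i
  simp [forwardParents, Fin.ext_iff]

theorem backwardParents_last (n : ℕ) : backwardParents (n + 2) (Fin.last (n + 1)) = ∅ := by
  ext i
  simp only [backwardParents, Finset.mem_filter, Finset.mem_univ, true_and, Fin.val_last,
    Finset.notMem_empty, iff_false]
  omega

theorem backwardParents_castSucc {n : ℕ} (j : Fin (n + 1)) :
    backwardParents (n + 2) j.castSucc = {j.succ} := by
  ext i
  simp only [backwardParents, Finset.mem_filter, Finset.mem_univ, true_and, Fin.val_castSucc,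
    Finset.mem_singleton, Fin.ext_iff, Fin.val_succ]
  omega

theorem marginal_of_eq_pair {V : Type*} [Fintype V] [DecidableEq V] {I : V → Type*}
    [∀ v, Fintype (I v)] [∀ v, DecidableEq (I v)] (x : ((v : V) → I v) → ℝ) {A : Finset V}
    {u v : V} (hA : A = {u, v}) (i : (v : V) → I v) :
    marginal x A (A.restrict i) = pair x u v (i u) (i v) := by
  have h : ∀ j : (v : V) → I v, A.restrict j = A.restrict i ↔ j u = i u ∧ j v = i v := by
    subst hA
    intro j
    constructor
    · intro h
      exact ⟨congrFun h ⟨u, by simp⟩, congrFun h ⟨v, by simp⟩⟩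
    · rintro ⟨h1, h2⟩
      funext ⟨a, ha⟩
      rcases Finset.mem_insert.1 ha with rfl | ha'
      · exact h1
      · obtain rfl := Finset.mem_singleton.1 ha'
        exact h2
  simp only [marginal, pair, h]

/-- The clique factorization of the chain as a product of forward conditional probabilities. -/
theorem IsPerfectCliqueOrder.prod_condProb_forwardParents {n K : ℕ} {I : Fin (n + 2) → Type*}
    [∀ v, Fintype (I v)] [∀ v, DecidableEq (I v)] [∀ v, Nonempty (I v)]
    {C : Fin K → Finset (Fin (n + 2))}
    (hC : IsPerfectCliqueOrder (SimpleGraph.pathGraph (n + 2)) C)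
    {x : ((v : Fin (n + 2)) → I v) → ℝ} (hx : ∀ i, 0 < x i) (i : (v : Fin (n + 2)) → I v) :
    ∏ v, condProb x v (forwardParents (n + 2) v) ((forwardParents (n + 2) v).restrict i) (i v) =
      (∏ l, marginal x (C l) ((C l).restrict i)) /
        ∏ l, marginal x (separator C l) ((separator C l).restrict i) := by
  obtain ⟨e, he⟩ := hC.exists_equiv_chainEdge
  obtain rfl : n + 1 = K := by simpa using Fintype.card_congr e
  have hcov : ∀ v, ∃ l, v ∈ C l := by
    intro v
    induction v using Fin.cases with
    | zero => exact ⟨e 0, by rw [he]; simp [chainEdge]⟩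
    | succ j => exact ⟨e j, by rw [he]; simp [chainEdge]⟩
  have hg : ∀ v, vert x v (i v) ≠ 0 := fun v => (vert_pos hx v _).ne'
  have htot : ∑ i, x i ≠ 0 := by
    rw [← sum_vert x 0]
    exact (Finset.sum_pos (fun k _ => vert_pos hx 0 k) Finset.univ_nonempty).ne'
  have h1 : ∏ l, marginal x (C l) ((C l).restrict i) =
      ∏ j : Fin (n + 1), pair x j.castSucc j.succ (i j.castSucc) (i j.succ) := by
    rw [← e.prod_comp]
    exact Finset.prod_congr rfl fun j _ => marginal_of_eq_pair x (he j) i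
  -- The first separator contributes the total mass. It is kept because the identity is also needed
  -- for the unnormalized tables a + r.
  have h2 : (∏ l, marginal x (separator C l) ((separator C l).restrict i)) =
      (∑ i, x i) * ∏ l, ∏ v ∈ separator C l, vert x v (i v) := by
    rw [Fin.prod_univ_succ, marginal_empty x (separator_zero C), Fin.prod_univ_succ (n := n)
      (fun l => ∏ v ∈ separator C l, vert x v (i v)), separator_zero, Finset.prod_empty, one_mul]
    congr 1
    refine Finset.prod_congr rfl fun l _ => ?_
    obtain ⟨w, hw⟩ := Finset.card_eq_one.1 (hC.card_separator_succ he l)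
    rw [marginal_of_eq_singleton x hw, hw, Finset.prod_singleton]
  have h3 := prod_separator_mul_prod C hcov (fun v => vert x v (i v))
  rw [← e.prod_comp (fun l => ∏ v ∈ C l, vert x v (i v))] at h3
  have h4 : ∀ j, ∏ v ∈ C (e j), vert x v (i v) =
      vert x j.castSucc (i j.castSucc) * vert x j.succ (i j.succ) := by
    intro j
    rw [he, chainEdge, Finset.prod_pair (Fin.castSucc_lt_succ).ne]
  simp only [h4, Finset.prod_mul_distrib] at h3
  rw [Fin.prod_univ_succ (fun v => vert x v (i v)), ← mul_assoc] at h3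
  have h3 := mul_right_cancel₀ (Finset.prod_ne_zero_iff.2 fun j _ => hg _) h3
  have h5 : ∏ j : Fin (n + 1), vert x j.castSucc (i j.castSucc) ≠ 0 :=
    Finset.prod_ne_zero_iff.2 fun j _ => hg _
  have h6 : ∏ l, ∏ v ∈ separator C l, vert x v (i v) ≠ 0 :=
    Finset.prod_ne_zero_iff.2 fun l _ => Finset.prod_ne_zero_iff.2 fun v _ => hg v
  rw [Fin.prod_univ_succ, condProb_eq, joint_empty _ _ (forwardParents_zero n),
    marginal_empty _ (forwardParents_zero n)]
  simp only [condProb_eq, joint_of_eq_singleton _ _ (forwardParents_succ _),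
    marginal_of_eq_singleton _ (forwardParents_succ _), Finset.prod_div_distrib]
  rw [h1, h2, ← h3]
  have := hg 0
  field_simp

/-! ### Edges with parameter independence in both directions -/

section Edge

variable {V : Type*} [Fintype V] [DecidableEq V] {I : V → Type*} [∀ v, Fintype (I v)]
  [∀ v, DecidableEq (I v)] {Ω : Type*} [MeasurableSpace Ω] {μ : Measure Ω}
  {p : Ω → ((v : V) → I v) → ℝ} [IsProbabilityMeasure μ] [∀ v, Nonempty (I v)]

/-- With a single value the conditional probability would be the constant 1, a degenerate vector. -/
theorem ParameterIndependence.nontrivial {pa : V → Finset V} (h : ParameterIndependence μ p pa)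
    (hp : IsRandomProbability μ p) (v : V) : Nontrivial (I v) := by
  by_contra hn
  rw [not_nontrivial_iff_subsingleton] at hn
  refine h.nondegenerate v ((pa v).restrict fun v => Classical.arbitrary (I v))
    ⟨fun _ => 1, ?_⟩
  filter_upwards [hp.pos] with ω hpos
  funext m
  have : joint (p ω) v (pa v) ((pa v).restrict fun v => Classical.arbitrary (I v)) m =
      marginal (p ω) (pa v) ((pa v).restrict fun v => Classical.arbitrary (I v)) := by
    rw [← sum_joint (p ω) v, Fintype.sum_subsingleton _ m]
  rw [condProb_eq, this, div_self (marginal_pos hpos _ _).ne']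

/-- The moments of the marginal of a vertex. -/
def vertMoment (μ : Measure Ω) (p : Ω → ((v : V) → I v) → ℝ) (u : V) (ρ : I u → ℕ) : ℝ :=
  ∫ ω, ∏ k, vert (p ω) u k ^ ρ k ∂μ

/-- The moments of the conditional distributions of `v` given `u`. -/
def rowMoment (μ : Measure Ω) (p : Ω → ((v : V) → I v) → ℝ) (u v : V) (k : I u)
    (s : I v → ℕ) : ℝ :=
  ∫ ω, ∏ m, (pair (p ω) u v k m / vert (p ω) u k) ^ s m ∂μ

/-- The moments of the two-way marginal of `u` and `v`. -/
def pairMoment (μ : Measure Ω) (p : Ω → ((v : V) → I v) → ℝ) (u v : V) (r : I u × I v → ℕ) : ℝ :=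
  ∫ ω, ∏ q, pair (p ω) u v q.1 q.2 ^ r q ∂μ

theorem IsRandomProbability.ae_vert (hp : IsRandomProbability μ p) (u : V) :
    (∀ᵐ ω ∂μ, ∀ k, 0 < vert (p ω) u k) ∧ ∀ᵐ ω ∂μ, ∑ k, vert (p ω) u k = 1 := by
  refine ⟨hp.pos.mono fun ω h k => vert_pos h u k, hp.sum_eq_one.mono fun ω h => ?_⟩
  rw [sum_vert, h]

theorem IsRandomProbability.ae_row (hp : IsRandomProbability μ p) {u v : V} (huv : u ≠ v)
    (k : I u) : (∀ᵐ ω ∂μ, ∀ m, 0 < pair (p ω) u v k m / vert (p ω) u k) ∧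
      ∀ᵐ ω ∂μ, ∑ m, pair (p ω) u v k m / vert (p ω) u k = 1 := by
  refine ⟨hp.pos.mono fun ω h m => div_pos (pair_pos h huv k m) (vert_pos h u k),
    hp.pos.mono fun ω h => ?_⟩
  rw [← Finset.sum_div, sum_pair_right, div_self (vert_pos h u k).ne']

theorem IsRandomProbability.ae_pair (hp : IsRandomProbability μ p) {u v : V} (huv : u ≠ v) :
    (∀ᵐ ω ∂μ, ∀ q : I u × I v, 0 < pair (p ω) u v q.1 q.2) ∧
      ∀ᵐ ω ∂μ, ∑ q : I u × I v, pair (p ω) u v q.1 q.2 = 1 := by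
  refine ⟨hp.pos.mono fun ω h q => pair_pos h huv _ _, hp.sum_eq_one.mono fun ω h => ?_⟩
  rw [Fintype.sum_prod_type]
  simp only [sum_pair_right, sum_vert, h]

theorem IsRandomProbability.integrable (hp : IsRandomProbability μ p)
    (i : (v : V) → I v) : Integrable (fun ω => p ω i) μ := by
  have := integrable_monomial hp.measurable hp.pos hp.sum_eq_one (Pi.single i 1)
  simpa only [prod_pow_single] using this

theorem pairMoment_single (u v : V) (q : I u × I v) :
    pairMoment μ p u v (Pi.single q 1) = ∫ ω, pair (p ω) u v q.1 q.2 ∂μ := by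
  simp only [pairMoment]
  refine integral_congr_ae (.of_forall fun ω => ?_)
  exact prod_pow_single (fun q : I u × I v => pair (p ω) u v q.1 q.2) q

theorem IsRandomProbability.sum_integral_pair (hp : IsRandomProbability μ p) (u v : V) (k : I u) :
    ∑ m, ∫ ω, pair (p ω) u v k m ∂μ = ∫ ω, vert (p ω) u k ∂μ := by
  have hint : ∀ m ∈ Finset.univ, Integrable (fun ω => pair (p ω) u v k m) μ :=
    fun m _ => integrable_finsetSum _ fun i _ => hp.integrable i
  rw [← integral_finsetSum _ hint]
  simp only [sum_pair_right]

/-- The vertex `u` has the moments of a Pólya urn with reinforcement `c`. -/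
def IsPolyaVertex (μ : Measure Ω) (p : Ω → ((v : V) → I v) → ℝ) (c : ℝ) (u : V) : Prop :=
  ∀ (ρ : I u → ℕ) k, vertMoment μ p u (ρ + Pi.single k 1) * (1 + c * (∑ k, ρ k : ℕ)) =
    vertMoment μ p u ρ * (∫ ω, vert (p ω) u k ∂μ + c * ρ k)

/-- The second moment of one value's probability X fixes c, because subtracting the two urn rules
gives (c - c')(E X - E X²) = 0. A second value of positive probability makes E X² < E X. -/
theorem IsPolyaVertex.unique (hp : IsRandomProbability μ p) {u : V} [Nontrivial (I u)] {c c' : ℝ}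
    (h : IsPolyaVertex μ p c u) (h' : IsPolyaVertex μ p c' u) : c = c' := by
  obtain ⟨k, k', hk⟩ := exists_pair_ne (I u)
  obtain ⟨hpos, hsum⟩ := hp.ae_vert u
  have h1 := h (Pi.single k 1) k
  have h2 := h' (Pi.single k 1) k
  have hm : vertMoment μ p u (Pi.single k 1) = ∫ ω, vert (p ω) u k ∂μ := by
    simp only [vertMoment, prod_pow_single]
  have hlt : vertMoment μ p u (Pi.single k 1 + Pi.single k 1) <
      vertMoment μ p u (Pi.single k 1) := by
    have hs := sum_integral_monomial (μ := μ) (hp.measurable_vert u) hpos hsum (Pi.single k 1)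
    have hp' := fun r => integral_monomial_pos (μ := μ) (hp.measurable_vert u) hpos hsum r
    simp only [vertMoment]
    rw [← hs]
    exact Finset.single_lt_sum
      (f := fun j => ∫ ω, ∏ i, vert (p ω) u i ^ (Pi.single k 1 + Pi.single j 1 : I u → ℕ) i ∂μ)
      hk.symm (Finset.mem_univ _) (Finset.mem_univ _) (hp' _)
      fun j _ _ => (hp' _).le
  rw [hm] at h1 h2 hlt
  simp only [Finset.sum_pi_single', Finset.mem_univ, if_true, Pi.single_eq_same, Nat.cast_one,
    mul_one] at h1 h2
  have hpos' : 0 < ∫ ω, vert (p ω) u k ∂μ := by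
    rw [← hm]
    exact integral_monomial_pos (μ := μ) (hp.measurable_vert u) hpos hsum _
  by_contra hne
  have h4 : (c - c') * (∫ ω, vert (p ω) u k ∂μ -
      vertMoment μ p u (Pi.single k 1 + Pi.single k 1)) = 0 := by
    linear_combination h2 - h1
  simp only [mul_eq_zero, sub_eq_zero] at h4
  rcases h4 with h4 | h4
  · exact hne h4
  · exact hlt.ne' h4

/-- Parameter independence in both directions along an edge makes its two-way table Dirichlet. -/
theorem exists_polya_edge {pa pb : V → Finset V} (ha : ParameterIndependence μ p pa)
    (hb : ParameterIndependence μ p pb) (hp : IsRandomProbability μ p) (ra rb : V → ℕ)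
    (hpa : ∀ v, pa v = ∅ ∨ ∃ u, pa v = {u} ∧ ra u < ra v)
    (hpb : ∀ v, pb v = ∅ ∨ ∃ u, pb v = {u} ∧ rb u < rb v) {u v : V} (huv : u ≠ v)
    (hav : pa v = {u}) (hbu : pb u = {v}) :
    ∃ c : ℝ, 0 < c ∧ IsPolyaVertex μ p c u ∧ IsPolyaVertex μ p c v ∧
      ∀ k s m, rowMoment μ p u v k (s + Pi.single m 1) *
          (∫ ω, vert (p ω) u k ∂μ + c * (∑ m, s m : ℕ)) =
        rowMoment μ p u v k s * (∫ ω, pair (p ω) u v k m ∂μ + c * s m) := by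
  have := ha.nontrivial hp u
  have := ha.nontrivial hp v
  have hmeas : ∀ q : I u × I v, Measurable fun ω => pair (p ω) u v q.1 q.2 :=
    fun q => hp.measurable_pair u v q.1 q.2
  obtain ⟨hpos, hsum⟩ := hp.ae_pair huv
  have hrow : ∀ r, pairMoment μ p u v r =
      vertMoment μ p u (fun k => ∑ l, r (k, l)) *
        ∏ k, rowMoment μ p u v k (fun l => r (k, l)) :=
    fun r => ha.integral_pair hp ra hpa hav r
  have hswap : ∀ r : I v × I u → ℕ,
      pairMoment μ p v u r = pairMoment μ p u v (fun q => r q.swap) := by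
    intro r
    simp only [pairMoment]
    refine integral_congr_ae (.of_forall fun ω => ?_)
    refine Fintype.prod_equiv (Equiv.prodComm _ _) _ _ fun q => ?_
    simp [pair_comm (p ω) v u]
  have hrow' : ∀ r, pairMoment μ p v u r =
      vertMoment μ p v (fun k => ∑ l, r (k, l)) *
        ∏ k, rowMoment μ p v u k (fun l => r (k, l)) :=
    fun r => hb.integral_pair hp rb hpb hbu r
  have hcol : ∀ r : I u × I v → ℕ, pairMoment μ p u v r =
      vertMoment μ p v (fun l => ∑ k, r (k, l)) *
        ∏ l, rowMoment μ p v u l (fun k => r (k, l)) := by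
    -- This is backward independence along the edge, read on the transposed table.
    intro r
    have h := hrow' (fun q => r q.swap)
    rw [hswap] at h
    simpa using h
  obtain ⟨c, hc, hM⟩ := polya_of_row_col (pairMoment μ p u v)
    (integral_monomial_pos hmeas hpos hsum) (by simp [pairMoment])
    (sum_integral_monomial hmeas hpos hsum) _ _ _ _ hrow hcol
  simp only [pairMoment_single] at hM
  have hvpos : ∀ u ρ, 0 < vertMoment μ p u ρ := fun u ρ =>
    integral_monomial_pos (hp.measurable_vert u) (hp.ae_vert u).1 (hp.ae_vert u).2 ρ
  have hrm : ∀ (u v : V) (k : I u) (m : I v),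
      Measurable fun ω => pair (p ω) u v k m / vert (p ω) u k :=
    fun u v k m => (hp.measurable_pair u v k m).div (hp.measurable_vert u k)
  have hrpos : ∀ (u v : V), u ≠ v → ∀ k s, 0 < rowMoment μ p u v k s := fun u v huv k s =>
    integral_monomial_pos (hrm u v k) (hp.ae_row huv k).1 (hp.ae_row huv k).2 s
  have hrsum : ∀ (u v : V), u ≠ v → ∀ k s,
      ∑ m, rowMoment μ p u v k (s + Pi.single m 1) = rowMoment μ p u v k s := fun u v huv k s =>
    sum_integral_monomial (hrm u v k) (hp.ae_row huv k).1 (hp.ae_row huv k).2 s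
  obtain ⟨h1, h2⟩ := polya_row_moments _ _ _ (hvpos u) (hrpos u v huv) (hrsum u v huv) hrow
    (fun q => ∫ ω, pair (p ω) u v q.1 q.2 ∂μ) hM
  have hM' : ∀ (r : I v × I u → ℕ) i, pairMoment μ p v u (r + Pi.single i 1) *
      (1 + c * (∑ k, r k : ℕ)) =
      pairMoment μ p v u r * (∫ ω, pair (p ω) v u i.1 i.2 ∂μ + c * r i) := by
    intro r i
    have h := hM (fun q => r q.swap) i.swap
    have e1 : (fun q : I u × I v => (r + Pi.single i 1 : I v × I u → ℕ) q.swap) =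
        (fun q => r q.swap) + Pi.single i.swap 1 := by
      funext q
      have : q.swap = i ↔ q = i.swap := by
        constructor
        · rintro rfl
          simp
        · rintro rfl
          simp
      simp [Pi.single_apply, this]
    have e2 : ∑ q : I u × I v, r q.swap = ∑ q, r q :=
      Fintype.sum_equiv (Equiv.prodComm _ _) _ _ fun q => by simp
    rw [hswap, hswap, e1, ← e2]
    simp only [pair_comm (p _) v u]
    simpa using h
  obtain ⟨h3, -⟩ := polya_row_moments _ _ _ (hvpos v) (hrpos v u huv.symm) (hrsum v u huv.symm)
    hrow' (fun q => ∫ ω, pair (p ω) v u q.1 q.2 ∂μ) hM'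
  simp only [hp.sum_integral_pair] at h1 h2 h3
  refine ⟨c, lt_of_le_of_ne hc ?_, h1, h3, h2⟩
  -- For c = 0 the second moment of each cell is the square of its mean, so a whole row, and with it
  -- a conditional vector, is almost surely constant.
  rintro rfl
  let i₀ : (v : V) → I v := fun v => Classical.arbitrary (I v)
  refine ha.nondegenerate v ((pa v).restrict i₀)
    ⟨fun m => (∫ ω, pair (p ω) u v (i₀ u) m ∂μ) / ∑ m, ∫ ω, pair (p ω) u v (i₀ u) m ∂μ, ?_⟩
  have hconst : ∀ m, ∀ᵐ ω ∂μ, pair (p ω) u v (i₀ u) m = ∫ ω, pair (p ω) u v (i₀ u) m ∂μ := by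
    intro m
    refine ae_eq_const_of_integral_sq (hp.measurable_pair u v _ m)
      (hpos.mono fun ω h => (h (i₀ u, m)).le) ?_ ?_
    · filter_upwards [hpos, hsum] with ω a b
      rw [← b]
      exact Finset.single_le_sum (f := fun q : I u × I v => pair (p ω) u v q.1 q.2)
        (fun q _ => (a q).le) (Finset.mem_univ (i₀ u, m))
    · have h := hM (Pi.single (i₀ u, m) 1) (i₀ u, m)
      rw [pairMoment_single, zero_mul, add_zero, mul_one, zero_mul, add_zero] at h
      rw [← h]
      simp only [pairMoment]
      refine integral_congr_ae (.of_forall fun ω => ?_)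
      simp only
      rw [prod_pow_add_single (fun q : I u × I v => pair (p ω) u v q.1 q.2),
        prod_pow_single (fun q : I u × I v => pair (p ω) u v q.1 q.2)]
  filter_upwards [ae_all_iff.2 hconst] with ω hω
  funext m
  rw [condProb_eq, joint_of_eq_singleton _ _ hav, marginal_of_eq_singleton _ hav, hω m,
    ← sum_pair_right (p ω) u v, Finset.sum_congr rfl fun m _ => hω m]

end Edge

/-! ### Gluing the edges with a common reinforcement -/

/-- The chain has the predictive probabilities of a hyper Dirichlet distribution. -/
theorem exists_condMoment_add_single {n : ℕ} {I : Fin (n + 2) → Type*} [∀ v, Fintype (I v)]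
    [∀ v, DecidableEq (I v)] [∀ v, Nonempty (I v)] {Ω : Type*} [MeasurableSpace Ω]
    {μ : Measure Ω} [IsProbabilityMeasure μ] {p : Ω → ((v : Fin (n + 2)) → I v) → ℝ}
    (hp : IsRandomProbability μ p)
    (hforward : ParameterIndependence μ p (forwardParents (n + 2)))
    (hbackward : ParameterIndependence μ p (backwardParents (n + 2))) :
    ∃ a : ((v : Fin (n + 2)) → I v) → ℝ, (∀ i, 0 < a i) ∧
      ∀ v i t, condMoment μ p v (forwardParents (n + 2) v) ((forwardParents (n + 2) v).restrict i)
          (t + Pi.single (i v) 1) *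
        (marginal a (forwardParents (n + 2) v) ((forwardParents (n + 2) v).restrict i) +
          (∑ m, t m : ℕ)) =
      condMoment μ p v (forwardParents (n + 2) v) ((forwardParents (n + 2) v).restrict i) t *
        (joint a v (forwardParents (n + 2) v) ((forwardParents (n + 2) v).restrict i) (i v) +
          t (i v)) := by
  have hpa : ∀ v, forwardParents (n + 2) v = ∅ ∨
      ∃ u, forwardParents (n + 2) v = {u} ∧ u.val < v.val := by
    intro v
    induction v using Fin.cases with
    | zero => exact Or.inl (forwardParents_zero n)
    | succ j => exact Or.inr ⟨_, forwardParents_succ j, by simp⟩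
  have hpb : ∀ v, backwardParents (n + 2) v = ∅ ∨
      ∃ u, backwardParents (n + 2) v = {u} ∧ u.rev.val < v.rev.val := by
    intro v
    induction v using Fin.lastCases with
    | last => exact Or.inl (backwardParents_last n)
    | cast j => exact Or.inr ⟨_, backwardParents_castSucc j, by simp; omega⟩
  choose c hc hcu hcv hrow using fun j : Fin (n + 1) =>
    exists_polya_edge hforward hbackward hp _ _ hpa hpb (Fin.castSucc_lt_succ (i := j)).ne
      (forwardParents_succ j) (backwardParents_castSucc j)
  -- The constant travels along the chain: at the left end of edge j uniqueness identifies c 0 with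
  -- c j, which also governs the right end.
  have hall : ∀ v, IsPolyaVertex μ p (c 0) v := by
    intro v
    induction v using Fin.induction with
    | zero => exact hcu 0
    | succ j ih =>
      have := hforward.nontrivial hp j.castSucc
      rw [ih.unique hp (hcu j)]
      exact hcv j
  have hceq : ∀ j, c j = c 0 := by
    intro j
    have := hforward.nontrivial hp j.castSucc
    exact (hcu j).unique hp (hall _)
  have hc0 := hc 0
  have hne := hc0.ne'
  have hvert : ∀ u k, vert (fun i => (∫ ω, p ω i ∂μ) / c 0) u k =
      (∫ ω, vert (p ω) u k ∂μ) / c 0 := by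
    intro u k
    simp only [vert]
    rw [integral_finsetSum _ fun i _ => hp.integrable i, Finset.sum_div]
  have hpair : ∀ u v k m, pair (fun i => (∫ ω, p ω i ∂μ) / c 0) u v k m =
      (∫ ω, pair (p ω) u v k m ∂μ) / c 0 := by
    intro u v k m
    simp only [pair]
    rw [integral_finsetSum _ fun i _ => hp.integrable i, Finset.sum_div]
  have htot : ∑ i, (∫ ω, p ω i ∂μ) / c 0 = 1 / c 0 := by
    rw [← Finset.sum_div, ← integral_finsetSum _ fun i _ => hp.integrable i,
      integral_congr_ae hp.sum_eq_one]
    simp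
  -- Dividing the urn rule by c turns means into Dirichlet parameters; the total parameter is 1 / c.
  refine ⟨fun i => (∫ ω, p ω i ∂μ) / c 0, fun i => ?_, fun v i t => ?_⟩
  · have := integral_monomial_pos hp.measurable hp.pos hp.sum_eq_one (Pi.single i 1)
    simp only [prod_pow_single] at this
    exact div_pos this hc0
  · induction v using Fin.cases with
    | zero =>
      have hΦ : ∀ t, condMoment μ p 0 (forwardParents (n + 2) 0)
          ((forwardParents (n + 2) 0).restrict i) t = vertMoment μ p 0 t := by
        intro t
        refine integral_congr_ae ?_
        filter_upwards [hp.sum_eq_one] with ω hω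
        simp only [condProb_eq, joint_empty _ _ (forwardParents_zero n),
          marginal_empty _ (forwardParents_zero n), hω, div_one]
      have h := hall 0 t (i 0)
      rw [hΦ, hΦ, joint_empty _ _ (forwardParents_zero n),
        marginal_empty _ (forwardParents_zero n), hvert, htot]
      field_simp
      exact h
    | succ j =>
      have hΦ : ∀ t, condMoment μ p j.succ (forwardParents (n + 2) j.succ)
          ((forwardParents (n + 2) j.succ).restrict i) t =
          rowMoment μ p j.castSucc j.succ (i j.castSucc) t := by
        intro t
        simp only [condMoment, rowMoment, condProb_eq,
          joint_of_eq_singleton _ _ (forwardParents_succ j),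
          marginal_of_eq_singleton _ (forwardParents_succ j)]
      have h := hrow j (i j.castSucc) t (i j.succ)
      rw [hceq] at h
      rw [hΦ, hΦ, joint_of_eq_singleton _ _ (forwardParents_succ j),
        marginal_of_eq_singleton _ (forwardParents_succ j), hvert, hpair]
      field_simp
      exact h

end HyperDirichlet

/-! ### The moment formula for the chain -/

theorem mainTheorem5 {d : ℕ} (hd : 2 ≤ d) {I : Fin d → Type*} [∀ v, Fintype (I v)]
    [∀ v, DecidableEq (I v)] {Ω : Type*} [MeasurableSpace Ω] (μ : Measure Ω)
    [IsProbabilityMeasure μ] (p : Ω → ((v : Fin d) → I v) → ℝ)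
    (hp : HyperDirichlet.IsRandomProbability μ p)
    (hG : ∀ᵐ ω ∂μ, HyperDirichlet.Factorizes (SimpleGraph.pathGraph d) (p ω))
    (hforward : HyperDirichlet.ParameterIndependence μ p (HyperDirichlet.forwardParents d))
    (hbackward : HyperDirichlet.ParameterIndependence μ p (HyperDirichlet.backwardParents d)) :
    HyperDirichlet.HasHyperDirichletLaw (SimpleGraph.pathGraph d) μ p := by
  open HyperDirichlet in
  obtain ⟨n, rfl⟩ : ∃ n, d = n + 2 := ⟨d - 2, by omega⟩
  have hne : ∀ v, Nonempty (I v) := hp.nonempty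
  have hfac : ∀ᵐ ω ∂μ, ∀ i, p ω i = ∏ v, condProb (p ω) v (forwardParents (n + 2) v)
      ((forwardParents (n + 2) v).restrict i) (i v) := by
    filter_upwards [hG, hp.pos, hp.sum_eq_one] with ω ⟨K, C, hC, h⟩ hpos hsum i
    rw [hC.prod_condProb_forwardParents hpos, h]
    congr 1
    -- The factorization omits the first separator, whose margin is the total mass 1.
    refine Finset.prod_subset (Finset.filter_subset _ _) fun l _ hl => ?_
    obtain ⟨K, rfl⟩ : ∃ K', K = K' + 1 := ⟨K - 1, by have := l.isLt; omega⟩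
    obtain rfl : l = 0 := by
      simpa [Fin.pos_iff_ne_zero] using hl
    rw [marginal_empty _ (separator_zero C), hsum]
  -- The factorization at one outcome supplies a perfect order; the computation below works for any.
  obtain ⟨ω, K, C, hC, -⟩ := hG.exists
  obtain ⟨a, ha, hΦ⟩ := exists_condMoment_add_single hp hforward hbackward
  refine ⟨K, C, hC, marginal a, isHyperParameter_marginal C a ha, fun r => ?_⟩
  have hadd : ∀ r : ((v : Fin (n + 2)) → I v) → ℕ,
      (fun A k => marginal a A k + ((marginal r A k : ℕ) : ℝ)) =
        marginal (fun i => a i + (r i : ℝ)) := by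
    intro r
    funext A k
    simp [marginal, Finset.sum_add_distrib]
  rw [hadd]
  induction r using table_induction with
  | h0 => simp [div_self (normConst_marginal_pos C a ha).ne']
  | hs r i ih =>
    have hpos : ∀ j, 0 < a j + (r j : ℝ) := fun j =>
      add_pos_of_pos_of_nonneg (ha j) (Nat.cast_nonneg _)
    have hstep : (fun j => a j +
        (((r + Pi.single i 1 : ((v : Fin (n + 2)) → I v) → ℕ) j : ℕ) : ℝ)) =
        (fun j => a j + (r j : ℝ)) + Pi.single i 1 := by
      funext j
      rcases eq_or_ne j i with rfl | h
      · simp [add_assoc]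
      · simp [h]
    rw [hforward.integral_table_add_single hp hfac a ha hΦ, ih, hstep,
      normConst_marginal_add_single C _ hpos, hC.prod_condProb_forwardParents hpos,
      div_mul_eq_mul_div]

end
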